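/- **Theorem (Preservation for Extended $F_{<:Q}$).** Let $\mathcal L$ be a countable bounded lattice, with order $\sqsubseteq$, meet $\sqcap$, join $\sqcup$ and bounds $\top,\bot$. Consider the following calculus. *Syntax* (up to renaming of bound variables; $x$, $X$, $Y$ are term, type and qualifier variables): - qualifiers $P,Q,R ::= l \mid Y \mid Q\wedge R \mid Q\vee R$, with $l\in\mathcal L$; - simple types $S ::= \top \mid X \mid T_1\to T_2 \mid \forall(X<:S).T \mid \forall(Y<:Q).T$; - qualified types $T ::= \{Q\}\,S$; - values $v ::= \lambda(x:T)_P.t \mid \Lambda(X<:S)_P.t \mid \Lambda(Y<:Q)_P.t$, where $P$ is the tag of the value; - terms $s,t ::= x \mid v \mid s\,t \mid s[S] \mid s\{\!\{Q\}\!\} \mid \mathsf{upqual}\,P\,s \mid \mathsf{assert}\,P\,s$; - environments $\Gamma ::= \varnothing \mid \Gamma,x:T \mid \Gamma,X<:S \mid \Gamma,Y<:Q$. All environments, types and qualifiers in the judgments are well formed: every variable is bound in the environment, and every entry of $\Gamma$ is well formed in the part of $\Gamma$ before it. The partial function $\mathrm{eval}$ from qualifiers to $\mathcal L$ is given by $\mathrm{eval}(l)=l$,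 $\mathrm{eval}(Q\wedge R)=\mathrm{eval}(Q)\sqcap\mathrm{eval}(R)$, $\mathrm{eval}(Q\vee R)=\mathrm{eval}(Q)\sqcup\mathrm{eval}(R)$; it is undefined if a variable occurs. *Subqualification* $\Gamma\vdash Q<:R$ is the least relation such that - $\Gamma\vdash Q<:\top$; $\ \Gamma\vdash\bot<:Q$; $\ \Gamma\vdash Y<:Y$; - if $(Y<:Q)\in\Gamma$ and $\Gamma\vdash Q<:R$, then $\Gamma\vdash Y<:R$; - if $\Gamma\vdash Q<:R_i$ for $i=1$ or $i=2$, then $\Gamma\vdash Q<:R_1\vee R_2$; if $\Gamma\vdash Q_i<:R$ for both $i$, then $\Gamma\vdash Q_1\vee Q_2<:R$; - if $\Gamma\vdash Q<:R_i$ for both $i$, then $\Gamma\vdash Q<:R_1\wedge R_2$; if $\Gamma\vdash Q_i<:R$ for $i=1$ or $i=2$, then $\Gamma\vdash Q_1\wedge Q_2<:R$; - (sq-lift) if $l_1\sqsubseteq l_2$, then $\Gamma\vdash l_1<:l_2$; - (sq-eval-elim) if $\Gamma\vdash Q<:M$, $\mathrm{eval}(M)=l$ and $\Gamma\vdash l<:R$,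 then $\Gamma\vdash Q<:R$; - (sq-eval-intro) if $\Gamma\vdash Q<:l$, $\mathrm{eval}(M)=l$ and $\Gamma\vdash M<:R$, then $\Gamma\vdash Q<:R$. *Subtyping* is the least relation such that - $\Gamma\vdash S<:\top$; $\ \Gamma\vdash X<:X$; if $(X<:S)\in\Gamma$ and $\Gamma\vdash S<:S'$, then $\Gamma\vdash X<:S'$; - if $\Gamma\vdash U_1<:T_1$ and $\Gamma\vdash T_2<:U_2$, then $\Gamma\vdash T_1\to T_2<:U_1\to U_2$; - if $\Gamma\vdash S_2<:S_1$ and $\Gamma,X<:S_2\vdash T_1<:T_2$, then $\Gamma\vdash\forall(X<:S_1).T_1<:\forall(X<:S_2).T_2$; - if $\Gamma\vdash Q_2<:Q_1$ and $\Gamma,Y<:Q_2\vdash T_1<:T_2$, then $\Gamma\vdash\forall(Y<:Q_1).T_1<:\forall(Y<:Q_2).T_2$; - if $\Gamma\vdash Q_1<:Q_2$ and $\Gamma\vdash S_1<:S_2$, then $\Gamma\vdash\{Q_1\}S_1<:\{Q_2\}S_2$. *Typing* is the least relation such that - if $(x:T)\in\Gamma$, then $\Gamma\vdash x:T$; if $\Gamma\vdash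 s:T_1$ and $\Gamma\vdash T_1<:T_2$, then $\Gamma\vdash s:T_2$; - if $\Gamma,x:T_1\vdash t:T_2$, then $\Gamma\vdash\lambda(x:T_1)_P.t:\{P\}(T_1\to T_2)$; if $\Gamma\vdash s:\{Q\}(T_1\to T_2)$ and $\Gamma\vdash t:T_1$, then $\Gamma\vdash s\,t:T_2$; - if $\Gamma,X<:S\vdash t:T$, then $\Gamma\vdash\Lambda(X<:S)_P.t:\{P\}\forall(X<:S).T$; if $\Gamma\vdash s:\{Q\}\forall(X<:S).T$ and $\Gamma\vdash S'<:S$, then $\Gamma\vdash s[S']:T[X\mapsto S']$; - if $\Gamma,Y<:Q\vdash t:T$, then $\Gamma\vdash\Lambda(Y<:Q)_P.t:\{P\}\forall(Y<:Q).T$; if $\Gamma\vdash s:\{R\}\forall(Y<:Q).T$ and $\Gamma\vdash Q'<:Q$, then $\Gamma\vdash s\{\!\{Q'\}\!\}:T[Y\mapsto Q']$; - if $\Gamma\vdash s:\{Q\}S$ and $\Gamma\vdash Q<:P$, then $\Gamma\vdash\mathsf{assert}\,P\,s:\{Q\}S$ and $\Gamma\vdash\mathsf{upqual}\,P\,s:\{P\}S$.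 *Reduction* $s\longrightarrow t$ is call-by-value, generated by - $(\lambda(x:T)_P.t)\,v\longrightarrow t[x\mapsto v]$, $\ (\Lambda(X<:S)_P.t)[S']\longrightarrow t[X\mapsto S']$, $\ (\Lambda(Y<:Q)_P.t)\{\!\{Q'\}\!\}\longrightarrow t[Y\mapsto Q']$; - if $v$ is a value with tag $Q$, and $\mathrm{eval}(Q)$ and $\mathrm{eval}(P)$ are defined with $\mathrm{eval}(Q)\sqsubseteq\mathrm{eval}(P)$, then $\mathsf{assert}\,P\,v\longrightarrow v$, and $\mathsf{upqual}\,P\,v\longrightarrow v'$, where $v'$ is $v$ with its tag replaced by $P$; - reduction in the evaluation contexts $E ::= [\,]\mid E\,t\mid v\,E\mid E[S]\mid E\{\!\{Q\}\!\}\mid\mathsf{upqual}\,P\,E\mid\mathsf{assert}\,P\,E$. Then for every environment $\Gamma$, all terms $s,t$ and every qualified type $T$: if $\Gamma\vdash s:T$ and $s\longrightarrow t$, then $\Gamma\vdash t:T$. -/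

import Mathlib

/-!
The calculus `F<:Q` over a bounded lattice `L` of base qualifiers.

Variables are de Bruijn indices, counted separately for the three sorts: term variables `x`,
type variables `X` (ranging over simple types) and qualifier variables `Y`. Index `0` is the
innermost binder of its sort.
-/

namespace FsubQ

universe u

/-- Qualifier expressions `P, Q, R ::= l | Y | Q ∧ R | Q ∨ R` with `l ∈ L`. -/
inductive Qual (L : Type u) where
  | base (l : L)
  | var (Y : ℕ)
  | meet (Q R : Qual L)
  | join (Q R : Qual L)

mutual
/-- Simple types `S ::= ⊤ | X | T₁ → T₂ | ∀(X <: S). T | ∀(Y <: Q). T`. -/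
inductive STy (L : Type u) where
  | top
  | var (X : ℕ)
  | arrow (T₁ T₂ : QTy L)
  | all (S : STy L) (T : QTy L)
  | qall (Q : Qual L) (T : QTy L)
/-- Qualified types `T ::= {Q} S`. -/
inductive QTy (L : Type u) where
  | mk (Q : Qual L) (S : STy L)
end

/-- Terms
`s, t ::= x | λ(x : T)_P. t | s t | Λ(X <: S)_P. t | s [S] | Λ(Y <: Q)_P. t | s {{Q}}
  | upqual P s | assert P s`;
the subscript `P` is the qualifier tag of the abstraction. -/
inductive Term (L : Type u) where
  | var (x : ℕ)
  | abs (P : Qual L) (T : QTy L) (t : Term L)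
  | app (s t : Term L)
  | tabs (P : Qual L) (S : STy L) (t : Term L)
  | tapp (s : Term L) (S : STy L)
  | qabs (P : Qual L) (Q : Qual L) (t : Term L)
  | qapp (s : Term L) (Q : Qual L)
  | upqual (P : Qual L) (s : Term L)
  | assertq (P : Qual L) (s : Term L)

/-- Environments `Γ ::= ∅ | Γ, x : T | Γ, X <: S | Γ, Y <: Q`. -/
inductive Ctx (L : Type u) where
  | nil
  | tm (Γ : Ctx L) (T : QTy L)
  | ty (Γ : Ctx L) (S : STy L)
  | qu (Γ : Ctx L) (Q : Qual L)

/-! ### Renaming and capture-avoiding simultaneous substitution -/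

/-- Extend a renaming under one binder of the renamed sort. -/
def upRen (ρ : ℕ → ℕ) : ℕ → ℕ
  | 0 => 0
  | n + 1 => ρ n + 1

section Substitution
variable {L : Type u}

def Qual.rename (ρ : ℕ → ℕ) : Qual L → Qual L
  | .base l => .base l
  | .var Y => .var (ρ Y)
  | .meet Q R => .meet (Q.rename ρ) (R.rename ρ)
  | .join Q R => .join (Q.rename ρ) (R.rename ρ)

def Qual.subst (σ : ℕ → Qual L) : Qual L → Qual L
  | .base l => .base l
  | .var Y => σ Y
  | .meet Q R => .meet (Q.subst σ) (R.subst σ)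
  | .join Q R => .join (Q.subst σ) (R.subst σ)

/-- Extend a qualifier substitution under a qualifier binder. -/
def Qual.up (σ : ℕ → Qual L) : ℕ → Qual L
  | 0 => .var 0
  | n + 1 => (σ n).rename Nat.succ

/-- The substitution `[Y ↦ Q]` for the innermost qualifier variable. -/
def Qual.single (Q : Qual L) : ℕ → Qual L
  | 0 => Q
  | n + 1 => .var n

mutual
/-- `ρX` renames type variables, `ρY` renames qualifier variables. -/
def STy.rename (ρX ρY : ℕ → ℕ) : STy L → STy L
  | .top => .top
  | .var X => .var (ρX X)
  | .arrow T₁ T₂ => .arrow (T₁.rename ρX ρY) (T₂.rename ρX ρY)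
  | .all S T => .all (S.rename ρX ρY) (T.rename (upRen ρX) ρY)
  | .qall Q T => .qall (Q.rename ρY) (T.rename ρX (upRen ρY))
def QTy.rename (ρX ρY : ℕ → ℕ) : QTy L → QTy L
  | .mk Q S => .mk (Q.rename ρY) (S.rename ρX ρY)
end

/-- Extend a type substitution under a type binder. -/
def STy.up (τ : ℕ → STy L) : ℕ → STy L
  | 0 => .var 0
  | n + 1 => (τ n).rename Nat.succ id

/-- The substitution `[X ↦ S]` for the innermost type variable. -/
def STy.single (S : STy L) : ℕ → STy L
  | 0 => S
  | n + 1 => .var n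

mutual
/-- `τ` substitutes for type variables, `σ` for qualifier variables. -/
def STy.subst (τ : ℕ → STy L) (σ : ℕ → Qual L) : STy L → STy L
  | .top => .top
  | .var X => τ X
  | .arrow T₁ T₂ => .arrow (T₁.subst τ σ) (T₂.subst τ σ)
  | .all S T => .all (S.subst τ σ) (T.subst (STy.up τ) σ)
  | .qall Q T =>
      .qall (Q.subst σ) (T.subst (fun n => (τ n).rename id Nat.succ) (Qual.up σ))
def QTy.subst (τ : ℕ → STy L) (σ : ℕ → Qual L) : QTy L → QTy L
  | .mk Q S => .mk (Q.subst σ) (S.subst τ σ)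
end

/-- `ρx`, `ρX`, `ρY` rename term, type and qualifier variables. -/
def Term.rename (ρx ρX ρY : ℕ → ℕ) : Term L → Term L
  | .var x => .var (ρx x)
  | .abs P T t => .abs (P.rename ρY) (T.rename ρX ρY) (t.rename (upRen ρx) ρX ρY)
  | .app s t => .app (s.rename ρx ρX ρY) (t.rename ρx ρX ρY)
  | .tabs P S t => .tabs (P.rename ρY) (S.rename ρX ρY) (t.rename ρx (upRen ρX) ρY)
  | .tapp s S => .tapp (s.rename ρx ρX ρY) (S.rename ρX ρY)
  | .qabs P Q t => .qabs (P.rename ρY) (Q.rename ρY) (t.rename ρx ρX (upRen ρY))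
  | .qapp s Q => .qapp (s.rename ρx ρX ρY) (Q.rename ρY)
  | .upqual P s => .upqual (P.rename ρY) (s.rename ρx ρX ρY)
  | .assertq P s => .assertq (P.rename ρY) (s.rename ρx ρX ρY)

/-- Extend a term substitution under a term binder. -/
def Term.up (θ : ℕ → Term L) : ℕ → Term L
  | 0 => .var 0
  | n + 1 => (θ n).rename Nat.succ id id

/-- The substitution `[x ↦ s]` for the innermost term variable. -/
def Term.single (s : Term L) : ℕ → Term L
  | 0 => s
  | n + 1 => .var n

/-- `θ`, `τ`, `σ` substitute for term, type and qualifier variables. -/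
def Term.subst (θ : ℕ → Term L) (τ : ℕ → STy L) (σ : ℕ → Qual L) : Term L → Term L
  | .var x => θ x
  | .abs P T t => .abs (P.subst σ) (T.subst τ σ) (t.subst (Term.up θ) τ σ)
  | .app s t => .app (s.subst θ τ σ) (t.subst θ τ σ)
  | .tabs P S t =>
      .tabs (P.subst σ) (S.subst τ σ)
        (t.subst (fun n => (θ n).rename id Nat.succ id) (STy.up τ) σ)
  | .tapp s S => .tapp (s.subst θ τ σ) (S.subst τ σ)
  | .qabs P Q t =>
      .qabs (P.subst σ) (Q.subst σ)
        (t.subst (fun n => (θ n).rename id id Nat.succ)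
          (fun n => (τ n).rename id Nat.succ) (Qual.up σ))
  | .qapp s Q => .qapp (s.subst θ τ σ) (Q.subst σ)
  | .upqual P s => .upqual (P.subst σ) (s.subst θ τ σ)
  | .assertq P s => .assertq (P.subst σ) (s.subst θ τ σ)

/-- `T[X ↦ S]`. -/
def QTy.substTy (T : QTy L) (S : STy L) : QTy L := T.subst (STy.single S) Qual.var

/-- `T[Y ↦ Q]`. -/
def QTy.substQual (T : QTy L) (Q : Qual L) : QTy L := T.subst STy.var (Qual.single Q)

/-- `t[x ↦ s]`. -/
def Term.substTerm (t s : Term L) : Term L := t.subst (Term.single s) STy.var Qual.var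

/-- `t[X ↦ S]`. -/
def Term.substTy (t : Term L) (S : STy L) : Term L := t.subst Term.var (STy.single S) Qual.var

/-- `t[Y ↦ Q]`. -/
def Term.substQual (t : Term L) (Q : Qual L) : Term L :=
  t.subst Term.var STy.var (Qual.single Q)

end Substitution

/-! ### Environments and well-formedness -/

section Environments
variable {L : Type u}

/-- `Y <: Q ∈ Γ`; the bound is weakened to the whole of `Γ`. -/
inductive HasQual : Ctx L → ℕ → Qual L → Prop
  | here {Γ Q} : HasQual (.qu Γ Q) 0 (Q.rename Nat.succ)
  | qu {Γ Y Q R} : HasQual Γ Y Q → HasQual (.qu Γ R) (Y + 1) (Q.rename Nat.succ)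
  | ty {Γ Y Q S} : HasQual Γ Y Q → HasQual (.ty Γ S) Y Q
  | tm {Γ Y Q T} : HasQual Γ Y Q → HasQual (.tm Γ T) Y Q

/-- `X <: S ∈ Γ`; the bound is weakened to the whole of `Γ`. -/
inductive HasTy : Ctx L → ℕ → STy L → Prop
  | here {Γ S} : HasTy (.ty Γ S) 0 (S.rename Nat.succ id)
  | ty {Γ X S U} : HasTy Γ X S → HasTy (.ty Γ U) (X + 1) (S.rename Nat.succ id)
  | qu {Γ X S R} : HasTy Γ X S → HasTy (.qu Γ R) X (S.rename id Nat.succ)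
  | tm {Γ X S T} : HasTy Γ X S → HasTy (.tm Γ T) X S

/-- `x : T ∈ Γ`; the type is weakened to the whole of `Γ`. -/
inductive HasTerm : Ctx L → ℕ → QTy L → Prop
  | here {Γ T} : HasTerm (.tm Γ T) 0 T
  | tm {Γ x T U} : HasTerm Γ x T → HasTerm (.tm Γ U) (x + 1) T
  | ty {Γ x T S} : HasTerm Γ x T → HasTerm (.ty Γ S) x (T.rename Nat.succ id)
  | qu {Γ x T R} : HasTerm Γ x T → HasTerm (.qu Γ R) x (T.rename id Nat.succ)

/-- All variables of the qualifier are bound in `Γ`. -/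
def Qual.WF (Γ : Ctx L) : Qual L → Prop
  | .base _ => True
  | .var Y => ∃ Q, HasQual Γ Y Q
  | .meet Q R => Q.WF Γ ∧ R.WF Γ
  | .join Q R => Q.WF Γ ∧ R.WF Γ

mutual
/-- All variables of the simple type are bound in `Γ`. -/
def STy.WF : Ctx L → STy L → Prop
  | _, .top => True
  | Γ, .var X => ∃ S, HasTy Γ X S
  | Γ, .arrow T₁ T₂ => T₁.WF Γ ∧ T₂.WF Γ
  | Γ, .all S T => S.WF Γ ∧ T.WF (.ty Γ S)
  | Γ, .qall Q T => Q.WF Γ ∧ T.WF (.qu Γ Q)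
/-- All variables of the qualified type are bound in `Γ`. -/
def QTy.WF : Ctx L → QTy L → Prop
  | Γ, .mk Q S => Q.WF Γ ∧ S.WF Γ
end

/-- Every bound or type in `Γ` is well formed in the part of `Γ` before it. -/
def Ctx.WF : Ctx L → Prop
  | .nil => True
  | .tm Γ T => Γ.WF ∧ T.WF Γ
  | .ty Γ S => Γ.WF ∧ S.WF Γ
  | .qu Γ Q => Γ.WF ∧ Q.WF Γ

end Environments

/-! ### Evaluation of qualifier expressions, subqualification, subtyping, typing -/

section Judgments
variable {L : Type u} [Lattice L]

/-- Partial evaluation of a qualifier expression to an element of `L`: it interprets textual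
meets and joins by those of `L` and is undefined if a variable occurs. -/
def Qual.eval : Qual L → Option L
  | .base l => some l
  | .var _ => none
  | .meet Q R => Q.eval.bind fun a => R.eval.bind fun b => some (a ⊓ b)
  | .join Q R => Q.eval.bind fun a => R.eval.bind fun b => some (a ⊔ b)

variable [BoundedOrder L]

/-- Subqualification `Γ ⊢ Q <: R`. The rules `evalElim` and `evalIntro` carry the transitivity
through a base lattice element `l` and an expression `M` that evaluates to it. With `M = Q`,
respectively `M = R`, they say that `eval Q = l` and `Γ ⊢ l <: R` give `Γ ⊢ Q <: R`, and that
`Γ ⊢ Q <: l` and `eval R = l` give `Γ ⊢ Q <: R`. -/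
inductive Subqual : Ctx L → Qual L → Qual L → Prop
  | top {Γ Q} : Γ.WF → Q.WF Γ → Subqual Γ Q (.base ⊤)
  | bot {Γ Q} : Γ.WF → Q.WF Γ → Subqual Γ (.base ⊥) Q
  | reflVar {Γ Y} : Γ.WF → (Qual.var Y).WF Γ → Subqual Γ (.var Y) (.var Y)
  | var {Γ Y Q R} : HasQual Γ Y Q → Subqual Γ Q R → Subqual Γ (.var Y) R
  | joinIntro₁ {Γ Q R₁ R₂} : Subqual Γ Q R₁ → R₂.WF Γ → Subqual Γ Q (.join R₁ R₂)
  | joinIntro₂ {Γ Q R₁ R₂} : R₁.WF Γ → Subqual Γ Q R₂ → Subqual Γ Q (.join R₁ R₂)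
  | joinElim {Γ Q₁ Q₂ R} : Subqual Γ Q₁ R → Subqual Γ Q₂ R → Subqual Γ (.join Q₁ Q₂) R
  | meetIntro {Γ Q R₁ R₂} : Subqual Γ Q R₁ → Subqual Γ Q R₂ → Subqual Γ Q (.meet R₁ R₂)
  | meetElim₁ {Γ Q₁ Q₂ R} : Subqual Γ Q₁ R → Q₂.WF Γ → Subqual Γ (.meet Q₁ Q₂) R
  | meetElim₂ {Γ Q₁ Q₂ R} : Q₁.WF Γ → Subqual Γ Q₂ R → Subqual Γ (.meet Q₁ Q₂) R
  | lift {Γ l₁ l₂} : Γ.WF → l₁ ≤ l₂ → Subqual Γ (.base l₁) (.base l₂)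
  | evalElim {Γ Q R M l} : Subqual Γ Q M → M.eval = some l → Subqual Γ (.base l) R →
      Subqual Γ Q R
  | evalIntro {Γ Q R M l} : Subqual Γ Q (.base l) → M.eval = some l → Subqual Γ M R →
      Subqual Γ Q R

mutual
/-- Subtyping `Γ ⊢ S₁ <: S₂` of simple types. -/
inductive STy.Sub : Ctx L → STy L → STy L → Prop
  | top {Γ S} : Γ.WF → S.WF Γ → STy.Sub Γ S .top
  | reflVar {Γ X} : Γ.WF → (STy.var X).WF Γ → STy.Sub Γ (.var X) (.var X)
  | var {Γ X S U} : HasTy Γ X S → STy.Sub Γ S U → STy.Sub Γ (.var X) U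
  | arrow {Γ T₁ T₂ U₁ U₂} : QTy.Sub Γ U₁ T₁ → QTy.Sub Γ T₂ U₂ →
      STy.Sub Γ (.arrow T₁ T₂) (.arrow U₁ U₂)
  | all {Γ S₁ S₂ T₁ T₂} : STy.Sub Γ S₂ S₁ → QTy.Sub (.ty Γ S₂) T₁ T₂ →
      STy.Sub Γ (.all S₁ T₁) (.all S₂ T₂)
  | qall {Γ Q₁ Q₂ T₁ T₂} : Subqual Γ Q₂ Q₁ → QTy.Sub (.qu Γ Q₂) T₁ T₂ →
      STy.Sub Γ (.qall Q₁ T₁) (.qall Q₂ T₂)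
/-- Subtyping `Γ ⊢ T₁ <: T₂` of qualified types. -/
inductive QTy.Sub : Ctx L → QTy L → QTy L → Prop
  | qtype {Γ Q₁ Q₂ S₁ S₂} : Subqual Γ Q₁ Q₂ → STy.Sub Γ S₁ S₂ →
      QTy.Sub Γ (.mk Q₁ S₁) (.mk Q₂ S₂)
end

/-- Typing `Γ ⊢ t : T`. -/
inductive Typing : Ctx L → Term L → QTy L → Prop
  | var {Γ x T} : Γ.WF → HasTerm Γ x T → Typing Γ (.var x) T
  | abs {Γ P T₁ t T₂} : P.WF Γ → Typing (.tm Γ T₁) t T₂ →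
      Typing Γ (.abs P T₁ t) (.mk P (.arrow T₁ T₂))
  | app {Γ s t Q T₁ T₂} : Typing Γ s (.mk Q (.arrow T₁ T₂)) → Typing Γ t T₁ →
      Typing Γ (.app s t) T₂
  | tabs {Γ P S t T} : P.WF Γ → Typing (.ty Γ S) t T →
      Typing Γ (.tabs P S t) (.mk P (.all S T))
  | tapp {Γ s Q S S' T} : Typing Γ s (.mk Q (.all S T)) → STy.Sub Γ S' S →
      Typing Γ (.tapp s S') (T.substTy S')
  | qabs {Γ P Q t T} : P.WF Γ → Typing (.qu Γ Q) t T →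
      Typing Γ (.qabs P Q t) (.mk P (.qall Q T))
  | qapp {Γ s R Q Q' T} : Typing Γ s (.mk R (.qall Q T)) → Subqual Γ Q' Q →
      Typing Γ (.qapp s Q') (T.substQual Q')
  | assertq {Γ s P Q S} : Typing Γ s (.mk Q S) → Subqual Γ Q P →
      Typing Γ (.assertq P s) (.mk Q S)
  | upqual {Γ s P Q S} : Typing Γ s (.mk Q S) → Subqual Γ Q P →
      Typing Γ (.upqual P s) (.mk P S)
  | sub {Γ s T₁ T₂} : Typing Γ s T₁ → QTy.Sub Γ T₁ T₂ → Typing Γ s T₂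

end Judgments

/-! ### Call-by-value reduction -/

section Reduction
variable {L : Type u}

/-- `ValueTag v P`: `v` is a value, that is, an abstraction of one of the three kinds, and `P` is
its tag. -/
inductive ValueTag : Term L → Qual L → Prop
  | abs {P T t} : ValueTag (.abs P T t) P
  | tabs {P S t} : ValueTag (.tabs P S t) P
  | qabs {P Q t} : ValueTag (.qabs P Q t) P

def Term.IsValue (v : Term L) : Prop := ∃ P, ValueTag v P

/-- Replace the tag of a value by `P`. -/
def Term.retag (P : Qual L) : Term L → Term L
  | .abs _ T t => .abs P T t
  | .tabs _ S t => .tabs P S t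
  | .qabs _ Q t => .qabs P Q t
  | t => t

/-- One-step reduction `s ⟶ t`. -/
inductive Step [Lattice L] : Term L → Term L → Prop
  | beta {P T t v} : v.IsValue → Step (.app (.abs P T t) v) (t.substTerm v)
  | betaT {P S t S'} : Step (.tapp (.tabs P S t) S') (t.substTy S')
  | betaQ {P Q t Q'} : Step (.qapp (.qabs P Q t) Q') (t.substQual Q')
  | upqual {P Q v p q} : ValueTag v Q → Q.eval = some q → P.eval = some p → q ≤ p →
      Step (.upqual P v) (v.retag P)
  | assertq {P Q v p q} : ValueTag v Q → Q.eval = some q → P.eval = some p → q ≤ p →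
      Step (.assertq P v) v
  | app₁ {s s' t} : Step s s' → Step (.app s t) (.app s' t)
  | app₂ {v t t'} : v.IsValue → Step t t' → Step (.app v t) (.app v t')
  | tapp {s s' S} : Step s s' → Step (.tapp s S) (.tapp s' S)
  | qapp {s s' Q} : Step s s' → Step (.qapp s Q) (.qapp s' Q)
  | upqualCongr {P s s'} : Step s s' → Step (.upqual P s) (.upqual P s')
  | assertqCongr {P s s'} : Step s s' → Step (.assertq P s) (.assertq P s')

end Reduction

end FsubQ

/-!
Every judgment is preserved by simultaneous substitutions that respect the bounds and types of
the environment; weakening, narrowing and the substitutions performed by reduction are instances.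

Substituting for type variables seems to need transitivity of subtyping (at the rule promoting a
variable to its bound), while transitivity needs narrowing, itself a substitution. The circle is
broken by asking of a type substituted for a variable only that, in every renaming of the
environment, each supertype of the bound is a supertype of that type. Substitution then needs no
transitivity, and transitivity follows by structural induction on the middle type, over all of its
renamings. Subqualification raises no such problem: `evalIntro` makes it transitive through the
base elements, and a derivation ending in any other qualifier can be composed rule by rule.

By transitivity, a typing of an abstraction is its introduction rule followed by one
subsumption. Inverting that subsumption gives the redexes, and it survives a change of tag because
tags are compared independently of simple types.
-/

namespace FsubQ

/-! ### Renamings and substitutions -/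

section Substitution
variable {L : Type*}

@[simp] theorem Qual.up_var : Qual.up (Qual.var : ℕ → Qual L) = Qual.var := by
  funext n; cases n <;> rfl

theorem Qual.up_comp (σ : ℕ → Qual L) (ρ : ℕ → ℕ) :
    Qual.up (σ ∘ ρ) = Qual.up σ ∘ upRen ρ := by
  funext n; cases n <;> rfl

theorem Qual.rename_subst (ρ : ℕ → ℕ) (σ : ℕ → Qual L) (Q : Qual L) :
    (Q.rename ρ).subst σ = Q.subst (σ ∘ ρ) := by
  induction Q <;> simp_all [Qual.rename, Qual.subst]

@[simp] theorem Qual.subst_var (Q : Qual L) : Q.subst Qual.var = Q := by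
  induction Q <;> simp_all [Qual.subst]

theorem Qual.rename_eq_subst (ρ : ℕ → ℕ) (Q : Qual L) : Q.rename ρ = Q.subst (Qual.var ∘ ρ) := by
  rw [← Qual.rename_subst, Qual.subst_var]

theorem Qual.rename_rename (ξ ρ : ℕ → ℕ) (Q : Qual L) :
    (Q.rename ρ).rename ξ = Q.rename (ξ ∘ ρ) := by
  rw [Qual.rename_eq_subst ξ, Qual.rename_subst, Qual.rename_eq_subst (ξ ∘ ρ)]; rfl

@[simp] theorem Qual.rename_id (Q : Qual L) : Q.rename id = Q :=
  (Qual.rename_eq_subst id Q).trans (Qual.subst_var Q)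

theorem Qual.subst_rename (σ : ℕ → Qual L) (ρ : ℕ → ℕ) (Q : Qual L) :
    (Q.subst σ).rename ρ = Q.subst (fun n => (σ n).rename ρ) := by
  induction Q <;> simp_all [Qual.rename, Qual.subst]

theorem Qual.rename_upRen_rename_succ (ρ : ℕ → ℕ) (Q : Qual L) :
    (Q.rename Nat.succ).rename (upRen ρ) = (Q.rename ρ).rename Nat.succ := by
  rw [Qual.rename_rename, Qual.rename_rename]; rfl

theorem Qual.up_rename (σ : ℕ → Qual L) (ρ : ℕ → ℕ) :
    Qual.up (fun n => (σ n).rename ρ) = fun n => (Qual.up σ n).rename (upRen ρ) := by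
  funext n
  cases n with
  | zero => rfl
  | succ n => exact (rename_upRen_rename_succ ..).symm

theorem Qual.subst_up_rename_succ (σ : ℕ → Qual L) (Q : Qual L) :
    (Q.rename Nat.succ).subst (Qual.up σ) = (Q.subst σ).rename Nat.succ := by
  rw [Qual.rename_subst, Qual.subst_rename]; rfl

theorem Qual.up_subst (σ σ' : ℕ → Qual L) :
    Qual.up (fun n => (σ n).subst σ') = fun n => (Qual.up σ n).subst (Qual.up σ') := by
  funext n
  cases n with
  | zero => rfl
  | succ n => exact (subst_up_rename_succ _ _).symm

theorem Qual.subst_subst (σ σ' : ℕ → Qual L) (Q : Qual L) :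
    (Q.subst σ).subst σ' = Q.subst (fun n => (σ n).subst σ') := by
  induction Q <;> simp_all [Qual.subst]

theorem Qual.subst_single_rename_succ (Q R : Qual L) :
    (Q.rename Nat.succ).subst (Qual.single R) = Q := by
  rw [Qual.rename_subst]; exact Qual.subst_var Q

/-- The extension of a type substitution under a qualifier binder, as it occurs in `STy.subst`. -/
abbrev STy.qup (τ : ℕ → STy L) : ℕ → STy L := fun n => (τ n).rename id Nat.succ

@[simp] theorem STy.up_var : STy.up (STy.var : ℕ → STy L) = STy.var := by
  funext n; cases n <;> rfl

theorem STy.up_comp (τ : ℕ → STy L) (ρ : ℕ → ℕ) :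
    STy.up (τ ∘ ρ) = STy.up τ ∘ upRen ρ := by
  funext n; cases n <;> rfl

mutual
theorem STy.rename_subst (ρX ρY : ℕ → ℕ) (τ : ℕ → STy L) (σ : ℕ → Qual L) : ∀ S : STy L,
    (S.rename ρX ρY).subst τ σ = S.subst (τ ∘ ρX) (σ ∘ ρY)
  | .top => rfl
  | .var _ => rfl
  | .arrow T₁ T₂ => by
      simp [STy.rename, STy.subst, QTy.rename_subst ρX ρY τ σ T₁, QTy.rename_subst ρX ρY τ σ T₂]
  | .all S T => by
      simp [STy.rename, STy.subst, STy.rename_subst ρX ρY τ σ S,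
        QTy.rename_subst (upRen ρX) ρY (STy.up τ) σ T, STy.up_comp]
  | .qall Q T => by
      simp only [STy.rename, STy.subst, Qual.rename_subst,
        QTy.rename_subst ρX (upRen ρY) (STy.qup τ) (Qual.up σ) T, Qual.up_comp]
      rfl
theorem QTy.rename_subst (ρX ρY : ℕ → ℕ) (τ : ℕ → STy L) (σ : ℕ → Qual L) : ∀ T : QTy L,
    (T.rename ρX ρY).subst τ σ = T.subst (τ ∘ ρX) (σ ∘ ρY)
  | .mk Q S => by
      simp [QTy.rename, QTy.subst, Qual.rename_subst, STy.rename_subst ρX ρY τ σ S]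
end

mutual
@[simp] theorem STy.subst_var : ∀ S : STy L, S.subst STy.var Qual.var = S
  | .top => rfl
  | .var _ => rfl
  | .arrow T₁ T₂ => by simp [STy.subst, QTy.subst_var T₁, QTy.subst_var T₂]
  | .all S T => by simp [STy.subst, STy.subst_var S, QTy.subst_var T]
  | .qall Q T => by simp [STy.subst, STy.rename, QTy.subst_var T]
@[simp] theorem QTy.subst_var : ∀ T : QTy L, T.subst STy.var Qual.var = T
  | .mk Q S => by simp [QTy.subst, STy.subst_var S]
end

theorem STy.rename_eq_subst (ρX ρY : ℕ → ℕ) (S : STy L) :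
    S.rename ρX ρY = S.subst (STy.var ∘ ρX) (Qual.var ∘ ρY) := by
  rw [← STy.rename_subst, STy.subst_var]

theorem QTy.rename_eq_subst (ρX ρY : ℕ → ℕ) (T : QTy L) :
    T.rename ρX ρY = T.subst (STy.var ∘ ρX) (Qual.var ∘ ρY) := by
  rw [← QTy.rename_subst, QTy.subst_var]

theorem STy.rename_rename (ξX ξY ρX ρY : ℕ → ℕ) (S : STy L) :
    (S.rename ρX ρY).rename ξX ξY = S.rename (ξX ∘ ρX) (ξY ∘ ρY) := by
  rw [STy.rename_eq_subst ξX, STy.rename_subst, STy.rename_eq_subst (ξX ∘ ρX)]; rfl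

theorem QTy.rename_rename (ξX ξY ρX ρY : ℕ → ℕ) (T : QTy L) :
    (T.rename ρX ρY).rename ξX ξY = T.rename (ξX ∘ ρX) (ξY ∘ ρY) := by
  rw [QTy.rename_eq_subst ξX, QTy.rename_subst, QTy.rename_eq_subst (ξX ∘ ρX)]; rfl

@[simp] theorem STy.rename_id (S : STy L) : S.rename id id = S :=
  (STy.rename_eq_subst id id S).trans (STy.subst_var S)

@[simp] theorem QTy.rename_id (T : QTy L) : T.rename id id = T :=
  (QTy.rename_eq_subst id id T).trans (QTy.subst_var T)

theorem STy.rename_upRen_rename_succ (ρX ρY : ℕ → ℕ) (S : STy L) :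
    (S.rename Nat.succ id).rename (upRen ρX) ρY = (S.rename ρX ρY).rename Nat.succ id := by
  rw [STy.rename_rename, STy.rename_rename]; rfl

theorem STy.rename_qupRen_rename_succ (ρX ρY : ℕ → ℕ) (S : STy L) :
    (S.rename id Nat.succ).rename ρX (upRen ρY) = (S.rename ρX ρY).rename id Nat.succ := by
  rw [STy.rename_rename, STy.rename_rename]; rfl

theorem QTy.rename_upRen_rename_succ (ρX ρY : ℕ → ℕ) (T : QTy L) :
    (T.rename Nat.succ id).rename (upRen ρX) ρY = (T.rename ρX ρY).rename Nat.succ id := by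
  rw [QTy.rename_rename, QTy.rename_rename]; rfl

theorem QTy.rename_qupRen_rename_succ (ρX ρY : ℕ → ℕ) (T : QTy L) :
    (T.rename id Nat.succ).rename ρX (upRen ρY) = (T.rename ρX ρY).rename id Nat.succ := by
  rw [QTy.rename_rename, QTy.rename_rename]; rfl

theorem STy.up_rename (τ : ℕ → STy L) (ρX ρY : ℕ → ℕ) :
    STy.up (fun n => (τ n).rename ρX ρY) = fun n => (STy.up τ n).rename (upRen ρX) ρY := by
  funext n
  cases n with
  | zero => rfl
  | succ n => exact (rename_upRen_rename_succ ..).symm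

mutual
theorem STy.subst_rename (τ : ℕ → STy L) (σ : ℕ → Qual L) (ρX ρY : ℕ → ℕ) : ∀ S : STy L,
    (S.subst τ σ).rename ρX ρY =
      S.subst (fun n => (τ n).rename ρX ρY) (fun n => (σ n).rename ρY)
  | .top => rfl
  | .var _ => rfl
  | .arrow T₁ T₂ => by
      simp [STy.rename, STy.subst, QTy.subst_rename τ σ ρX ρY T₁, QTy.subst_rename τ σ ρX ρY T₂]
  | .all S T => by
      simp [STy.rename, STy.subst, STy.subst_rename τ σ ρX ρY S,
        QTy.subst_rename (STy.up τ) σ (upRen ρX) ρY T, STy.up_rename]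
  | .qall Q T => by
      simp [STy.rename, STy.subst, Qual.subst_rename, STy.rename_rename,
        QTy.subst_rename (STy.qup τ) (Qual.up σ) ρX (upRen ρY) T, Qual.up_rename,
        Function.comp_def, upRen]
theorem QTy.subst_rename (τ : ℕ → STy L) (σ : ℕ → Qual L) (ρX ρY : ℕ → ℕ) : ∀ T : QTy L,
    (T.subst τ σ).rename ρX ρY =
      T.subst (fun n => (τ n).rename ρX ρY) (fun n => (σ n).rename ρY)
  | .mk Q S => by
      simp [QTy.rename, QTy.subst, Qual.subst_rename, STy.subst_rename τ σ ρX ρY S]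
end

theorem STy.subst_up_rename_succ (τ : ℕ → STy L) (σ : ℕ → Qual L) (S : STy L) :
    (S.rename Nat.succ id).subst (STy.up τ) σ = (S.subst τ σ).rename Nat.succ id := by
  rw [STy.rename_subst, STy.subst_rename]; simp only [Qual.rename_id]; rfl

theorem QTy.subst_up_rename_succ (τ : ℕ → STy L) (σ : ℕ → Qual L) (T : QTy L) :
    (T.rename Nat.succ id).subst (STy.up τ) σ = (T.subst τ σ).rename Nat.succ id := by
  rw [QTy.rename_subst, QTy.subst_rename]; simp only [Qual.rename_id]; rfl

theorem STy.subst_qup_rename_succ (τ : ℕ → STy L) (σ : ℕ → Qual L) (S : STy L) :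
    (S.rename id Nat.succ).subst (STy.qup τ) (Qual.up σ) =
      (S.subst τ σ).rename id Nat.succ := by
  rw [STy.rename_subst, STy.subst_rename]; rfl

theorem QTy.subst_qup_rename_succ (τ : ℕ → STy L) (σ : ℕ → Qual L) (T : QTy L) :
    (T.rename id Nat.succ).subst (STy.qup τ) (Qual.up σ) =
      (T.subst τ σ).rename id Nat.succ := by
  rw [QTy.rename_subst, QTy.subst_rename]; rfl

theorem STy.up_subst (τ τ' : ℕ → STy L) (σ' : ℕ → Qual L) :
    STy.up (fun n => (τ n).subst τ' σ') = fun n => (STy.up τ n).subst (STy.up τ') σ' := by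
  funext n
  cases n with
  | zero => rfl
  | succ n => exact (subst_up_rename_succ _ _ _).symm

mutual
theorem STy.subst_subst (τ τ' : ℕ → STy L) (σ σ' : ℕ → Qual L) : ∀ S : STy L,
    (S.subst τ σ).subst τ' σ' =
      S.subst (fun n => (τ n).subst τ' σ') (fun n => (σ n).subst σ')
  | .top => rfl
  | .var _ => rfl
  | .arrow T₁ T₂ => by
      simp [STy.subst, QTy.subst_subst τ τ' σ σ' T₁, QTy.subst_subst τ τ' σ σ' T₂]
  | .all S T => by
      simp [STy.subst, STy.subst_subst τ τ' σ σ' S,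
        QTy.subst_subst (STy.up τ) (STy.up τ') σ σ' T, STy.up_subst]
  | .qall Q T => by
      simp [STy.subst, Qual.subst_subst, STy.subst_qup_rename_succ,
        QTy.subst_subst (STy.qup τ) (STy.qup τ') (Qual.up σ) (Qual.up σ') T, Qual.up_subst]
theorem QTy.subst_subst (τ τ' : ℕ → STy L) (σ σ' : ℕ → Qual L) : ∀ T : QTy L,
    (T.subst τ σ).subst τ' σ' =
      T.subst (fun n => (τ n).subst τ' σ') (fun n => (σ n).subst σ')
  | .mk Q S => by
      simp [QTy.subst, Qual.subst_subst, STy.subst_subst τ τ' σ σ' S]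
end

theorem STy.subst_single_rename_succ (S U : STy L) :
    (S.rename Nat.succ id).subst (STy.single U) Qual.var = S := by
  rw [STy.rename_subst]; exact STy.subst_var S

theorem QTy.subst_single_rename_succ (T : QTy L) (U : STy L) :
    (T.rename Nat.succ id).subst (STy.single U) Qual.var = T := by
  rw [QTy.rename_subst]; exact QTy.subst_var T

theorem STy.subst_qsingle_rename_succ (S : STy L) (R : Qual L) :
    (S.rename id Nat.succ).subst STy.var (Qual.single R) = S := by
  rw [STy.rename_subst]; exact STy.subst_var S

theorem QTy.subst_qsingle_rename_succ (T : QTy L) (R : Qual L) :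
    (T.rename id Nat.succ).subst STy.var (Qual.single R) = T := by
  rw [QTy.rename_subst]; exact QTy.subst_var T

theorem QTy.subst_substTy (τ : ℕ → STy L) (σ : ℕ → Qual L) (T : QTy L) (S : STy L) :
    (T.substTy S).subst τ σ = (T.subst (STy.up τ) σ).substTy (S.subst τ σ) := by
  simp only [QTy.substTy, QTy.subst_subst, Qual.subst_var]
  congr 1
  funext n
  cases n with
  | zero => rfl
  | succ n => exact (STy.subst_single_rename_succ _ _).symm

theorem QTy.subst_substQual (τ : ℕ → STy L) (σ : ℕ → Qual L) (T : QTy L) (Q : Qual L) :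
    (T.substQual Q).subst τ σ =
      (T.subst (STy.qup τ) (Qual.up σ)).substQual (Q.subst σ) := by
  simp only [QTy.substQual, QTy.subst_subst, STy.subst_qsingle_rename_succ]
  congr 1
  funext n
  cases n with
  | zero => rfl
  | succ n => exact (Qual.subst_single_rename_succ _ _).symm

theorem QTy.rename_substTy (ρX ρY : ℕ → ℕ) (T : QTy L) (S : STy L) :
    (T.substTy S).rename ρX ρY = (T.rename (upRen ρX) ρY).substTy (S.rename ρX ρY) := by
  simp only [QTy.rename_eq_subst, STy.rename_eq_subst, QTy.subst_substTy, STy.up_comp, STy.up_var]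

theorem QTy.rename_substQual (ρX ρY : ℕ → ℕ) (T : QTy L) (Q : Qual L) :
    (T.substQual Q).rename ρX ρY = (T.rename ρX (upRen ρY)).substQual (Q.rename ρY) := by
  simp only [QTy.rename_eq_subst, Qual.rename_eq_subst, QTy.subst_substQual, Qual.up_comp,
    Qual.up_var]
  rfl

end Substitution

/-! ### Well-formedness -/

section WellFormedness
variable {L : Type*} {Γ Δ : Ctx L}

@[simp] theorem Qual.wf_var_qu_zero {R : Qual L} : (Qual.var 0).WF (.qu Γ R) :=
  ⟨_, .here⟩

@[simp] theorem Qual.wf_var_qu_succ {R : Qual L} {Y : ℕ} :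
    (Qual.var (Y + 1)).WF (.qu Γ R) ↔ (Qual.var Y).WF Γ :=
  ⟨fun ⟨_, .qu h⟩ => ⟨_, h⟩, fun ⟨_, h⟩ => ⟨_, .qu h⟩⟩

@[simp] theorem Qual.wf_var_ty {S : STy L} {Y : ℕ} :
    (Qual.var Y).WF (.ty Γ S) ↔ (Qual.var Y).WF Γ :=
  ⟨fun ⟨_, .ty h⟩ => ⟨_, h⟩, fun ⟨_, h⟩ => ⟨_, .ty h⟩⟩

@[simp] theorem Qual.wf_var_tm {T : QTy L} {Y : ℕ} :
    (Qual.var Y).WF (.tm Γ T) ↔ (Qual.var Y).WF Γ :=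
  ⟨fun ⟨_, .tm h⟩ => ⟨_, h⟩, fun ⟨_, h⟩ => ⟨_, .tm h⟩⟩

@[simp] theorem STy.wf_var_ty_zero {S : STy L} : (STy.var 0).WF (.ty Γ S) :=
  ⟨_, .here⟩

@[simp] theorem STy.wf_var_ty_succ {S : STy L} {X : ℕ} :
    (STy.var (X + 1)).WF (.ty Γ S) ↔ (STy.var X).WF Γ :=
  ⟨fun ⟨_, .ty h⟩ => ⟨_, h⟩, fun ⟨_, h⟩ => ⟨_, .ty h⟩⟩

@[simp] theorem STy.wf_var_qu {R : Qual L} {X : ℕ} :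
    (STy.var X).WF (.qu Γ R) ↔ (STy.var X).WF Γ :=
  ⟨fun ⟨_, .qu h⟩ => ⟨_, h⟩, fun ⟨_, h⟩ => ⟨_, .qu h⟩⟩

@[simp] theorem STy.wf_var_tm {T : QTy L} {X : ℕ} :
    (STy.var X).WF (.tm Γ T) ↔ (STy.var X).WF Γ :=
  ⟨fun ⟨_, .tm h⟩ => ⟨_, h⟩, fun ⟨_, h⟩ => ⟨_, .tm h⟩⟩

theorem Qual.WF.subst {σ : ℕ → Qual L} (hσ : ∀ Y, (Qual.var Y).WF Γ → (σ Y).WF Δ) {Q : Qual L}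
    (h : Q.WF Γ) : (Q.subst σ).WF Δ := by
  induction Q with
  | base => trivial
  | var Y => exact hσ Y h
  | meet _ _ ih₁ ih₂ => exact ⟨ih₁ h.1, ih₂ h.2⟩
  | join _ _ ih₁ ih₂ => exact ⟨ih₁ h.1, ih₂ h.2⟩

theorem Qual.WF.rename {ρ : ℕ → ℕ} (hρ : ∀ Y, (Qual.var Y).WF Γ → (Qual.var (ρ Y)).WF Δ)
    {Q : Qual L} (h : Q.WF Γ) : (Q.rename ρ).WF Δ :=
  Q.rename_eq_subst ρ ▸ h.subst hρ

theorem Qual.WF.mono (hY : ∀ Y, (Qual.var Y).WF Γ → (Qual.var Y).WF Δ) {Q : Qual L}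
    (h : Q.WF Γ) : Q.WF Δ :=
  Q.subst_var ▸ h.subst hY

theorem Qual.WF.weaken_qu {Q R : Qual L} (h : Q.WF Γ) : (Q.rename Nat.succ).WF (.qu Γ R) :=
  h.rename (by simp)

theorem Qual.WF.weaken_ty {Q : Qual L} {S : STy L} (h : Q.WF Γ) : Q.WF (.ty Γ S) :=
  h.mono (by simp)

theorem Qual.WF.weaken_tm {Q : Qual L} {T : QTy L} (h : Q.WF Γ) : Q.WF (.tm Γ T) :=
  h.mono (by simp)

theorem Qual.WF.up {σ : ℕ → Qual L} (hσ : ∀ Y, (Qual.var Y).WF Γ → (σ Y).WF Δ) (Q R : Qual L) :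
    ∀ Y, (Qual.var Y).WF (.qu Γ Q) → (Qual.up σ Y).WF (.qu Δ R)
  | 0, _ => wf_var_qu_zero
  | Y + 1, h => (hσ Y (wf_var_qu_succ.1 h)).weaken_qu

theorem Qual.WF.upRen {ρ : ℕ → ℕ} (hρ : ∀ Y, (Qual.var Y).WF Γ → (Qual.var (ρ Y)).WF Δ)
    (Q R : Qual L) : ∀ Y, (Qual.var Y).WF (.qu Γ Q) → (Qual.var (upRen ρ Y)).WF (.qu Δ R)
  | 0, _ => wf_var_qu_zero
  | Y + 1, h => wf_var_qu_succ.2 (hρ Y (wf_var_qu_succ.1 h))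

theorem STy.WF.upRen {ρ : ℕ → ℕ} (hρ : ∀ X, (STy.var X).WF Γ → (STy.var (ρ X)).WF Δ)
    (S U : STy L) : ∀ X, (STy.var X).WF (.ty Γ S) → (STy.var (upRen ρ X)).WF (.ty Δ U)
  | 0, _ => wf_var_ty_zero
  | X + 1, h => wf_var_ty_succ.2 (hρ X (wf_var_ty_succ.1 h))

mutual
theorem STy.WF.rename {Γ Δ : Ctx L} {ρX ρY : ℕ → ℕ}
    (hX : ∀ X, (STy.var X).WF Γ → (STy.var (ρX X)).WF Δ)
    (hY : ∀ Y, (Qual.var Y).WF Γ → (Qual.var (ρY Y)).WF Δ) :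
    ∀ {S : STy L}, S.WF Γ → (S.rename ρX ρY).WF Δ
  | .top, _ => trivial
  | .var X, h => hX X h
  | .arrow _ _, h => ⟨QTy.WF.rename hX hY h.1, QTy.WF.rename hX hY h.2⟩
  | .all _ _, h => ⟨STy.WF.rename hX hY h.1,
      QTy.WF.rename (STy.WF.upRen hX _ _) (by simpa using hY) h.2⟩
  | .qall _ _, h => ⟨h.1.rename hY,
      QTy.WF.rename (by simpa using hX) (Qual.WF.upRen hY _ _) h.2⟩
theorem QTy.WF.rename {Γ Δ : Ctx L} {ρX ρY : ℕ → ℕ}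
    (hX : ∀ X, (STy.var X).WF Γ → (STy.var (ρX X)).WF Δ)
    (hY : ∀ Y, (Qual.var Y).WF Γ → (Qual.var (ρY Y)).WF Δ) :
    ∀ {T : QTy L}, T.WF Γ → (T.rename ρX ρY).WF Δ
  | .mk _ _, h => ⟨h.1.rename hY, STy.WF.rename hX hY h.2⟩
end

theorem STy.WF.weaken_qu {S : STy L} {R : Qual L} (h : S.WF Γ) :
    (S.rename id Nat.succ).WF (.qu Γ R) := h.rename (by simp) (by simp)

theorem STy.WF.weaken_ty {S U : STy L} (h : S.WF Γ) :
    (S.rename Nat.succ id).WF (.ty Γ U) := h.rename (by simp) (by simp)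

theorem QTy.WF.weaken_qu {T : QTy L} {R : Qual L} (h : T.WF Γ) :
    (T.rename id Nat.succ).WF (.qu Γ R) := h.rename (by simp) (by simp)

theorem QTy.WF.weaken_ty {T : QTy L} {U : STy L} (h : T.WF Γ) :
    (T.rename Nat.succ id).WF (.ty Γ U) := h.rename (by simp) (by simp)

theorem STy.WF.up {τ : ℕ → STy L} (hτ : ∀ X, (STy.var X).WF Γ → (τ X).WF Δ) (S U : STy L) :
    ∀ X, (STy.var X).WF (.ty Γ S) → (STy.up τ X).WF (.ty Δ U)
  | 0, _ => wf_var_ty_zero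
  | X + 1, h => (hτ X (wf_var_ty_succ.1 h)).weaken_ty

mutual
theorem STy.WF.subst {Γ Δ : Ctx L} {τ : ℕ → STy L} {σ : ℕ → Qual L}
    (hX : ∀ X, (STy.var X).WF Γ → (τ X).WF Δ) (hY : ∀ Y, (Qual.var Y).WF Γ → (σ Y).WF Δ) :
    ∀ {S : STy L}, S.WF Γ → (S.subst τ σ).WF Δ
  | .top, _ => trivial
  | .var X, h => hX X h
  | .arrow _ _, h => ⟨QTy.WF.subst hX hY h.1, QTy.WF.subst hX hY h.2⟩
  | .all _ _, h => ⟨STy.WF.subst hX hY h.1, QTy.WF.subst (STy.WF.up hX _ _)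
      (fun Y hb => (hY Y (Qual.wf_var_ty.1 hb)).weaken_ty) h.2⟩
  | .qall _ _, h => ⟨h.1.subst hY, QTy.WF.subst
      (fun X hb => (hX X (STy.wf_var_qu.1 hb)).weaken_qu) (Qual.WF.up hY _ _) h.2⟩
theorem QTy.WF.subst {Γ Δ : Ctx L} {τ : ℕ → STy L} {σ : ℕ → Qual L}
    (hX : ∀ X, (STy.var X).WF Γ → (τ X).WF Δ) (hY : ∀ Y, (Qual.var Y).WF Γ → (σ Y).WF Δ) :
    ∀ {T : QTy L}, T.WF Γ → (T.subst τ σ).WF Δ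
  | .mk _ _, h => ⟨h.1.subst hY, STy.WF.subst hX hY h.2⟩
end

theorem QTy.WF.mono (hX : ∀ X, (STy.var X).WF Γ → (STy.var X).WF Δ)
    (hY : ∀ Y, (Qual.var Y).WF Γ → (Qual.var Y).WF Δ) {T : QTy L} (h : T.WF Γ) : T.WF Δ :=
  T.subst_var ▸ h.subst hX hY

theorem QTy.WF.change_ty {S U : STy L} {T : QTy L} (h : T.WF (.ty Γ S)) : T.WF (.ty Γ U) :=
  h.mono (fun X => by cases X <;> simp) (by simp)

theorem QTy.WF.change_qu {Q R : Qual L} {T : QTy L} (h : T.WF (.qu Γ Q)) : T.WF (.qu Γ R) :=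
  h.mono (by simp) (fun Y => by cases Y <;> simp)

theorem QTy.WF.weaken_tm {T U : QTy L} (h : T.WF Γ) : T.WF (.tm Γ U) :=
  h.mono (by simp) (by simp)

theorem QTy.WF.strengthen_tm {T U : QTy L} (h : T.WF (.tm Γ U)) : T.WF Γ :=
  h.mono (by simp) (by simp)

theorem HasQual.wf {Y : ℕ} {Q : Qual L} (h : HasQual Γ Y Q) (hΓ : Γ.WF) : Q.WF Γ := by
  induction h with
  | here => exact hΓ.2.weaken_qu
  | qu _ ih => exact (ih hΓ.1).weaken_qu
  | ty _ ih => exact (ih hΓ.1).weaken_ty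
  | tm _ ih => exact (ih hΓ.1).weaken_tm

theorem HasTerm.wf {x : ℕ} {T : QTy L} (h : HasTerm Γ x T) (hΓ : Γ.WF) : T.WF Γ := by
  induction h with
  | here => exact hΓ.2.weaken_tm
  | qu _ ih => exact (ih hΓ.1).weaken_qu
  | ty _ ih => exact (ih hΓ.1).weaken_ty
  | tm _ ih => exact (ih hΓ.1).weaken_tm

end WellFormedness

/-! ### Subqualification -/

section Subqualification
variable {L : Type*} [Lattice L]

theorem Qual.eval_subst (σ : ℕ → Qual L) {Q : Qual L} {l : L} (h : Q.eval = some l) :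
    (Q.subst σ).eval = some l := by
  induction Q generalizing l with
  | base => exact h
  | var => cases h
  | meet _ _ ih₁ ih₂ | join _ _ ih₁ ih₂ =>
    simp only [Qual.subst, Qual.eval, Option.bind_eq_some_iff] at h ⊢
    obtain ⟨a, ha, b, hb, hab⟩ := h
    exact ⟨a, ih₁ ha, b, ih₂ hb, hab⟩

variable [BoundedOrder L] {Γ Δ : Ctx L}

theorem Subqual.wf {Q R : Qual L} (h : Subqual Γ Q R) : Γ.WF ∧ Q.WF Γ ∧ R.WF Γ := by
  induction h with
  | top hΓ hQ => exact ⟨hΓ, hQ, trivial⟩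
  | bot hΓ hQ => exact ⟨hΓ, trivial, hQ⟩
  | reflVar hΓ hY => exact ⟨hΓ, hY, hY⟩
  | var hY _ ih => exact ⟨ih.1, ⟨_, hY⟩, ih.2.2⟩
  | joinIntro₁ _ hR ih => exact ⟨ih.1, ih.2.1, ih.2.2, hR⟩
  | joinIntro₂ hR _ ih => exact ⟨ih.1, ih.2.1, hR, ih.2.2⟩
  | joinElim _ _ ih₁ ih₂ => exact ⟨ih₁.1, ⟨ih₁.2.1, ih₂.2.1⟩, ih₁.2.2⟩
  | meetIntro _ _ ih₁ ih₂ => exact ⟨ih₁.1, ih₁.2.1, ih₁.2.2, ih₂.2.2⟩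
  | meetElim₁ _ hQ ih => exact ⟨ih.1, ⟨ih.2.1, hQ⟩, ih.2.2⟩
  | meetElim₂ hQ _ ih => exact ⟨ih.1, ⟨hQ, ih.2.1⟩, ih.2.2⟩
  | lift hΓ _ => exact ⟨hΓ, trivial, trivial⟩
  | evalElim _ _ _ ih₁ ih₂ | evalIntro _ _ _ ih₁ ih₂ => exact ⟨ih₁.1, ih₁.2.1, ih₂.2.2⟩

theorem Subqual.refl (hΓ : Γ.WF) {Q : Qual L} (hQ : Q.WF Γ) : Subqual Γ Q Q := by
  induction Q with
  | base l => exact .lift hΓ le_rfl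
  | var Y => exact .reflVar hΓ hQ
  | meet _ _ ih₁ ih₂ =>
    exact .meetIntro (.meetElim₁ (ih₁ hQ.1) hQ.2) (.meetElim₂ hQ.1 (ih₂ hQ.2))
  | join _ _ ih₁ ih₂ =>
    exact .joinElim (.joinIntro₁ (ih₁ hQ.1) hQ.2) (.joinIntro₂ hQ.1 (ih₂ hQ.2))

theorem Subqual.of_join {Q₁ Q₂ R : Qual L} (h : Subqual Γ (.join Q₁ Q₂) R) :
    Subqual Γ Q₁ R ∧ Subqual Γ Q₂ R := by
  generalize hQ : Qual.join Q₁ Q₂ = Q at h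
  induction h with
  | top hΓ hwf => subst hQ; exact ⟨.top hΓ hwf.1, .top hΓ hwf.2⟩
  | joinIntro₁ _ hR ih => exact ⟨.joinIntro₁ (ih hQ).1 hR, .joinIntro₁ (ih hQ).2 hR⟩
  | joinIntro₂ hR _ ih => exact ⟨.joinIntro₂ hR (ih hQ).1, .joinIntro₂ hR (ih hQ).2⟩
  | joinElim h₁ h₂ => cases hQ; exact ⟨h₁, h₂⟩
  | meetIntro _ _ ih₁ ih₂ =>
    exact ⟨.meetIntro (ih₁ hQ).1 (ih₂ hQ).1, .meetIntro (ih₁ hQ).2 (ih₂ hQ).2⟩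
  | evalElim _ hM h ih => exact ⟨.evalElim (ih hQ).1 hM h, .evalElim (ih hQ).2 hM h⟩
  | evalIntro _ hM h ih => exact ⟨.evalIntro (ih hQ).1 hM h, .evalIntro (ih hQ).2 hM h⟩
  | _ => cases hQ

theorem Subqual.cut_meet {Q M₁ M₂ R : Qual L} (hQ : Q.WF Γ)
    (hM₁ : ∀ R, Subqual Γ M₁ R → Subqual Γ Q R) (hM₂ : ∀ R, Subqual Γ M₂ R → Subqual Γ Q R)
    (h : Subqual Γ (.meet M₁ M₂) R) : Subqual Γ Q R := by
  generalize hM : Qual.meet M₁ M₂ = M at h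
  induction h with
  | top hΓ _ => exact .top hΓ hQ
  | joinIntro₁ _ hR ih => exact .joinIntro₁ (ih hM) hR
  | joinIntro₂ hR _ ih => exact .joinIntro₂ hR (ih hM)
  | meetIntro _ _ ih₁ ih₂ => exact .meetIntro (ih₁ hM) (ih₂ hM)
  | meetElim₁ h => cases hM; exact hM₁ _ h
  | meetElim₂ _ h => cases hM; exact hM₂ _ h
  | evalElim _ he h ih => exact .evalElim (ih hM) he h
  | evalIntro _ he h ih => exact .evalIntro (ih hM) he h
  | _ => cases hM

theorem Subqual.trans {Q M R : Qual L} (h₁ : Subqual Γ Q M) (h₂ : Subqual Γ M R) :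
    Subqual Γ Q R := by
  induction h₁ generalizing R with
  | top hΓ hQ => exact .evalIntro (.top hΓ hQ) rfl h₂
  | lift hΓ hl => exact .evalIntro (.lift hΓ hl) rfl h₂
  | bot hΓ _ => exact .bot hΓ h₂.wf.2.2
  | reflVar => exact h₂
  | var hY _ ih => exact .var hY (ih h₂)
  | joinIntro₁ _ _ ih => exact ih h₂.of_join.1
  | joinIntro₂ _ _ ih => exact ih h₂.of_join.2
  | joinElim _ _ ih₁ ih₂ => exact .joinElim (ih₁ h₂) (ih₂ h₂)
  | meetIntro h _ ih₁ ih₂ => exact h₂.cut_meet h.wf.2.1 (fun _ => ih₁) (fun _ => ih₂)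
  | meetElim₁ _ hQ ih => exact .meetElim₁ (ih h₂) hQ
  | meetElim₂ hQ _ ih => exact .meetElim₂ hQ (ih h₂)
  | evalElim h hM _ _ ih => exact .evalElim h hM (ih h₂)
  | evalIntro h hM _ _ ih => exact .evalIntro h hM (ih h₂)

theorem Subqual.subst {σ : ℕ → Qual L} (hΔ : Δ.WF)
    (hσ : ∀ {Y Q}, HasQual Γ Y Q → Subqual Δ (σ Y) (Q.subst σ)) {Q R : Qual L}
    (h : Subqual Γ Q R) : Subqual Δ (Q.subst σ) (R.subst σ) := by
  have wf : ∀ Y, (Qual.var Y).WF Γ → (σ Y).WF Δ := fun _ ⟨_, hY⟩ => (hσ hY).wf.2.1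
  induction h with
  | top _ hQ => exact .top hΔ (hQ.subst wf)
  | bot _ hQ => exact .bot hΔ (hQ.subst wf)
  | reflVar _ hY => exact .refl hΔ (wf _ hY)
  | var hY _ ih => exact (hσ hY).trans ih
  | joinIntro₁ _ hR ih => exact .joinIntro₁ ih (hR.subst wf)
  | joinIntro₂ hR _ ih => exact .joinIntro₂ (hR.subst wf) ih
  | joinElim _ _ ih₁ ih₂ => exact .joinElim ih₁ ih₂
  | meetIntro _ _ ih₁ ih₂ => exact .meetIntro ih₁ ih₂
  | meetElim₁ _ hQ ih => exact .meetElim₁ ih (hQ.subst wf)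
  | meetElim₂ hQ _ ih => exact .meetElim₂ (hQ.subst wf) ih
  | lift _ hl => exact .lift hΔ hl
  | evalElim _ hM _ ih₁ ih₂ => exact .evalElim ih₁ (Qual.eval_subst σ hM) ih₂
  | evalIntro _ hM _ ih₁ ih₂ => exact .evalIntro ih₁ (Qual.eval_subst σ hM) ih₂

end Subqualification

/-! ### Renamings and substitutions between environments -/

section Renaming
variable {L : Type*} {Γ Δ Θ : Ctx L} {ρX ρY ξX ξY : ℕ → ℕ}

/-- The pair `ρX`, `ρY` renames the type and qualifier variables of `Γ` to variables of the
well-formed environment `Δ` that have the renamed bounds. Term variables are ignored. -/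
structure IsRenaming (Γ Δ : Ctx L) (ρX ρY : ℕ → ℕ) : Prop where
  wf : Δ.WF
  hasQual : ∀ {Y Q}, HasQual Γ Y Q → HasQual Δ (ρY Y) (Q.rename ρY)
  hasTy : ∀ {X S}, HasTy Γ X S → HasTy Δ (ρX X) (S.rename ρX ρY)

namespace IsRenaming

protected theorem id (hΓ : Γ.WF) : IsRenaming Γ Γ id id where
  wf := hΓ
  hasQual hY := by simpa using hY
  hasTy hX := by simpa using hX

theorem comp (h₂ : IsRenaming Δ Θ ξX ξY) (h₁ : IsRenaming Γ Δ ρX ρY) :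
    IsRenaming Γ Θ (ξX ∘ ρX) (ξY ∘ ρY) where
  wf := h₂.wf
  hasQual hY := Qual.rename_rename ξY ρY _ ▸ h₂.hasQual (h₁.hasQual hY)
  hasTy hX := STy.rename_rename ξX ξY ρX ρY _ ▸ h₂.hasTy (h₁.hasTy hX)

theorem weaken_ty {S : STy L} (hΓ : (Ctx.ty Γ S).WF) : IsRenaming Γ (.ty Γ S) Nat.succ id where
  wf := hΓ
  hasQual hY := by simpa using hY.ty
  hasTy hX := hX.ty

theorem weaken_qu {Q : Qual L} (hΓ : (Ctx.qu Γ Q).WF) : IsRenaming Γ (.qu Γ Q) id Nat.succ where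
  wf := hΓ
  hasQual hY := hY.qu
  hasTy hX := hX.qu

theorem weaken_tm {T : QTy L} (hΓ : (Ctx.tm Γ T).WF) : IsRenaming Γ (.tm Γ T) id id where
  wf := hΓ
  hasQual hY := by simpa using hY.tm
  hasTy hX := by simpa using hX.tm

theorem qual_wf (h : IsRenaming Γ Δ ρX ρY) {Q : Qual L} (hQ : Q.WF Γ) : (Q.rename ρY).WF Δ :=
  hQ.rename fun _ ⟨_, hY⟩ => ⟨_, h.hasQual hY⟩

theorem sTy_wf (h : IsRenaming Γ Δ ρX ρY) {S : STy L} (hS : S.WF Γ) :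
    (S.rename ρX ρY).WF Δ :=
  hS.rename (fun _ ⟨_, hX⟩ => ⟨_, h.hasTy hX⟩) fun _ ⟨_, hY⟩ => ⟨_, h.hasQual hY⟩

theorem qTy_wf (h : IsRenaming Γ Δ ρX ρY) {T : QTy L} (hT : T.WF Γ) :
    (T.rename ρX ρY).WF Δ :=
  hT.rename (fun _ ⟨_, hX⟩ => ⟨_, h.hasTy hX⟩) fun _ ⟨_, hY⟩ => ⟨_, h.hasQual hY⟩

theorem up_ty (h : IsRenaming Γ Δ ρX ρY) {S : STy L} (hS : S.WF Γ) :
    IsRenaming (.ty Γ S) (.ty Δ (S.rename ρX ρY)) (upRen ρX) ρY where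
  wf := ⟨h.wf, h.sTy_wf hS⟩
  hasQual | .ty hY => .ty (h.hasQual hY)
  hasTy
    | .here => STy.rename_upRen_rename_succ ρX ρY _ ▸ .here
    | .ty hX => STy.rename_upRen_rename_succ ρX ρY _ ▸ .ty (h.hasTy hX)

theorem up_qu (h : IsRenaming Γ Δ ρX ρY) {Q : Qual L} (hQ : Q.WF Γ) :
    IsRenaming (.qu Γ Q) (.qu Δ (Q.rename ρY)) ρX (upRen ρY) where
  wf := ⟨h.wf, h.qual_wf hQ⟩
  hasQual
    | .here => Qual.rename_upRen_rename_succ ρY _ ▸ .here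
    | .qu hY => Qual.rename_upRen_rename_succ ρY _ ▸ .qu (h.hasQual hY)
  hasTy | .qu hX => STy.rename_qupRen_rename_succ ρX ρY _ ▸ .qu (h.hasTy hX)

theorem up_tm (h : IsRenaming Γ Δ ρX ρY) {T : QTy L} (hT : T.WF Γ) :
    IsRenaming (.tm Γ T) (.tm Δ (T.rename ρX ρY)) ρX ρY where
  wf := ⟨h.wf, h.qTy_wf hT⟩
  hasQual | .tm hY => .tm (h.hasQual hY)
  hasTy | .tm hX => .tm (h.hasTy hX)

end IsRenaming

end Renaming

section Subtyping
variable {L : Type*} [Lattice L] [BoundedOrder L] {Γ Δ Θ : Ctx L} {ρX ρY : ℕ → ℕ}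
  {τ : ℕ → STy L} {σ : ℕ → Qual L}

theorem IsRenaming.subqual (h : IsRenaming Γ Δ ρX ρY) {Y : ℕ} {Q : Qual L} (hY : HasQual Γ Y Q) :
    Subqual Δ (.var (ρY Y)) (Q.subst (Qual.var ∘ ρY)) :=
  Qual.rename_eq_subst ρY Q ▸ .var (h.hasQual hY) (.refl h.wf ((h.hasQual hY).wf h.wf))

theorem Subqual.rename (hρ : IsRenaming Γ Δ ρX ρY) {Q R : Qual L} (h : Subqual Γ Q R) :
    Subqual Δ (Q.rename ρY) (R.rename ρY) := by
  rw [Qual.rename_eq_subst, Qual.rename_eq_subst]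
  exact h.subst hρ.wf hρ.subqual

mutual
theorem STy.Sub.wf : ∀ {Γ : Ctx L} {S U : STy L}, STy.Sub Γ S U → Γ.WF ∧ S.WF Γ ∧ U.WF Γ
  | _, _, _, .top hΓ hS => ⟨hΓ, hS, trivial⟩
  | _, _, _, .reflVar hΓ hX => ⟨hΓ, hX, hX⟩
  | _, _, _, .var hX h => ⟨h.wf.1, ⟨_, hX⟩, h.wf.2.2⟩
  | _, _, _, .arrow h₁ h₂ => ⟨h₁.wf.1, ⟨h₁.wf.2.2, h₂.wf.2.1⟩, h₁.wf.2.1, h₂.wf.2.2⟩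
  | _, _, _, .all h₁ h₂ => ⟨h₁.wf.1, ⟨h₁.wf.2.2, h₂.wf.2.1.change_ty⟩, h₁.wf.2.1, h₂.wf.2.2⟩
  | _, _, _, .qall h₁ h₂ => ⟨h₁.wf.1, ⟨h₁.wf.2.2, h₂.wf.2.1.change_qu⟩, h₁.wf.2.1, h₂.wf.2.2⟩
theorem QTy.Sub.wf : ∀ {Γ : Ctx L} {T U : QTy L}, QTy.Sub Γ T U → Γ.WF ∧ T.WF Γ ∧ U.WF Γ
  | _, _, _, .qtype h₁ h₂ => ⟨h₁.wf.1, ⟨h₁.wf.2.1, h₂.wf.2.1⟩, h₁.wf.2.2, h₂.wf.2.2⟩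
end

mutual
theorem STy.Sub.refl : ∀ {Γ : Ctx L} {S : STy L}, Γ.WF → S.WF Γ → STy.Sub Γ S S
  | _, .top, hΓ, hS => .top hΓ hS
  | _, .var _, hΓ, hS => .reflVar hΓ hS
  | _, .arrow _ _, hΓ, hS => .arrow (QTy.Sub.refl hΓ hS.1) (QTy.Sub.refl hΓ hS.2)
  | _, .all _ _, hΓ, hS => .all (STy.Sub.refl hΓ hS.1) (QTy.Sub.refl ⟨hΓ, hS.1⟩ hS.2)
  | _, .qall _ _, hΓ, hS => .qall (Subqual.refl hΓ hS.1) (QTy.Sub.refl ⟨hΓ, hS.1⟩ hS.2)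
theorem QTy.Sub.refl : ∀ {Γ : Ctx L} {T : QTy L}, Γ.WF → T.WF Γ → QTy.Sub Γ T T
  | _, .mk _ _, hΓ, hT => .qtype (Subqual.refl hΓ hT.1) (STy.Sub.refl hΓ hT.2)
end

/-- In every renaming of `Γ`, all supertypes of `M` are supertypes of `S`. For well-formed `Γ` and
`M`, transitivity makes this equivalent to `STy.Sub Γ S M`; in this form it lets substitution
preserve subtyping before transitivity is known. -/
structure STy.Refines (Γ : Ctx L) (S M : STy L) : Prop where
  wf : S.WF Γ
  sub : ∀ {Δ ρX ρY U}, IsRenaming Γ Δ ρX ρY →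
    STy.Sub Δ (M.rename ρX ρY) U → STy.Sub Δ (S.rename ρX ρY) U

namespace STy.Refines

theorem of_hasTy {X : ℕ} {S : STy L} (hX : HasTy Γ X S) : STy.Refines Γ (.var X) S where
  wf := ⟨_, hX⟩
  sub hρ h := .var (hρ.hasTy hX) h

theorem trans {S M N : STy L} (h₁ : STy.Refines Γ S M) (h₂ : STy.Refines Γ M N) :
    STy.Refines Γ S N where
  wf := h₁.wf
  sub hρ h := h₁.sub hρ (h₂.sub hρ h)

theorem rename {S M : STy L} (h : STy.Refines Γ S M) (hρ : IsRenaming Γ Δ ρX ρY) :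
    STy.Refines Δ (S.rename ρX ρY) (M.rename ρX ρY) where
  wf := hρ.sTy_wf h.wf
  sub hξ hU := by
    rw [STy.rename_rename] at hU ⊢
    exact h.sub (hξ.comp hρ) hU

end STy.Refines

/-- The pair `τ`, `σ` substitutes for the type and qualifier variables of `Γ` types and
qualifiers over the well-formed environment `Δ` that satisfy the substituted bounds. Term
variables are ignored. -/
structure IsSubstitution (Γ Δ : Ctx L) (τ : ℕ → STy L) (σ : ℕ → Qual L) : Prop where
  wf : Δ.WF
  subqual : ∀ {Y Q}, HasQual Γ Y Q → Subqual Δ (σ Y) (Q.subst σ)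
  refines : ∀ {X S}, HasTy Γ X S → STy.Refines Δ (τ X) (S.subst τ σ)

theorem IsRenaming.isSubstitution (h : IsRenaming Γ Δ ρX ρY) :
    IsSubstitution Γ Δ (STy.var ∘ ρX) (Qual.var ∘ ρY) where
  wf := h.wf
  subqual := h.subqual
  refines hX := STy.rename_eq_subst ρX ρY _ ▸ .of_hasTy (h.hasTy hX)

namespace IsSubstitution

protected theorem id (hΓ : Γ.WF) : IsSubstitution Γ Γ STy.var Qual.var :=
  (IsRenaming.id hΓ).isSubstitution

theorem rename (h : IsSubstitution Γ Δ τ σ) (hρ : IsRenaming Δ Θ ρX ρY) :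
    IsSubstitution Γ Θ (fun n => (τ n).rename ρX ρY) (fun n => (σ n).rename ρY) where
  wf := hρ.wf
  subqual hY := Qual.subst_rename σ ρY _ ▸ (h.subqual hY).rename hρ
  refines hX := STy.subst_rename τ σ ρX ρY _ ▸ (h.refines hX).rename hρ

theorem extend_ty {S : STy L} (h : IsSubstitution Γ Δ (τ ∘ Nat.succ) σ)
    (hS : STy.Refines Δ (τ 0) (S.subst (τ ∘ Nat.succ) σ)) :
    IsSubstitution (.ty Γ S) Δ τ σ where
  wf := h.wf
  subqual | .ty hY => h.subqual hY
  refines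
    | .here => STy.rename_subst Nat.succ id τ σ _ ▸ hS
    | .ty hX => STy.rename_subst Nat.succ id τ σ _ ▸ h.refines hX

theorem extend_qu {Q : Qual L} (h : IsSubstitution Γ Δ τ (σ ∘ Nat.succ))
    (hQ : Subqual Δ (σ 0) (Q.subst (σ ∘ Nat.succ))) : IsSubstitution (.qu Γ Q) Δ τ σ where
  wf := h.wf
  subqual
    | .here => Qual.rename_subst Nat.succ σ _ ▸ hQ
    | .qu hY => Qual.rename_subst Nat.succ σ _ ▸ h.subqual hY
  refines | .qu hX => STy.rename_subst id Nat.succ τ σ _ ▸ h.refines hX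

theorem extend_tm (h : IsSubstitution Γ Δ τ σ) (T : QTy L) : IsSubstitution (.tm Γ T) Δ τ σ where
  wf := h.wf
  subqual | .tm hY => h.subqual hY
  refines | .tm hX => h.refines hX

theorem qual_wf (h : IsSubstitution Γ Δ τ σ) {Q : Qual L} (hQ : Q.WF Γ) : (Q.subst σ).WF Δ :=
  hQ.subst fun _ ⟨_, hY⟩ => (h.subqual hY).wf.2.1

theorem sTy_wf (h : IsSubstitution Γ Δ τ σ) {S : STy L} (hS : S.WF Γ) : (S.subst τ σ).WF Δ :=
  hS.subst (fun _ ⟨_, hX⟩ => (h.refines hX).wf) fun _ ⟨_, hY⟩ => (h.subqual hY).wf.2.1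

theorem qTy_wf (h : IsSubstitution Γ Δ τ σ) {T : QTy L} (hT : T.WF Γ) : (T.subst τ σ).WF Δ :=
  hT.subst (fun _ ⟨_, hX⟩ => (h.refines hX).wf) fun _ ⟨_, hY⟩ => (h.subqual hY).wf.2.1

theorem up_ty (h : IsSubstitution Γ Δ τ σ) {S : STy L} (hS : S.WF Γ) :
    IsSubstitution (.ty Γ S) (.ty Δ (S.subst τ σ)) (STy.up τ) σ := by
  have hwk := h.rename (.weaken_ty (S := S.subst τ σ) ⟨h.wf, h.sTy_wf hS⟩)
  simp only [Qual.rename_id] at hwk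
  refine extend_ty hwk (.of_hasTy ?_)
  exact (STy.rename_subst Nat.succ id (STy.up τ) σ S).symm.trans
    (STy.subst_up_rename_succ τ σ S) ▸ .here

theorem up_qu (h : IsSubstitution Γ Δ τ σ) {Q : Qual L} (hQ : Q.WF Γ) :
    IsSubstitution (.qu Γ Q) (.qu Δ (Q.subst σ)) (STy.qup τ) (Qual.up σ) := by
  have hΔ : (Ctx.qu Δ (Q.subst σ)).WF := ⟨h.wf, h.qual_wf hQ⟩
  refine extend_qu (h.rename (.weaken_qu hΔ)) ?_
  rw [← Qual.rename_subst, Qual.subst_up_rename_succ]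
  exact .var .here (.refl hΔ hΔ.2.weaken_qu)

theorem up_tm (h : IsSubstitution Γ Δ τ σ) {T : QTy L} (hT : T.WF Γ) :
    IsSubstitution (.tm Γ T) (.tm Δ (T.subst τ σ)) τ σ := by
  have hwk := h.rename (.weaken_tm (T := T.subst τ σ) ⟨h.wf, h.qTy_wf hT⟩)
  simp only [STy.rename_id, Qual.rename_id] at hwk
  exact hwk.extend_tm T

theorem narrow_ty (hΓ : Γ.WF) {S U : STy L} (h : STy.Refines Γ U S) :
    IsSubstitution (.ty Γ S) (.ty Γ U) STy.var Qual.var := by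
  have hwk := IsRenaming.weaken_ty (S := U) ⟨hΓ, h.wf⟩
  refine extend_ty hwk.isSubstitution ((STy.Refines.of_hasTy .here).trans ?_)
  exact STy.rename_eq_subst Nat.succ id S ▸ h.rename hwk

theorem narrow_qu {Q R : Qual L} (h : Subqual Γ R Q) :
    IsSubstitution (.qu Γ Q) (.qu Γ R) STy.var Qual.var := by
  have hwk := IsRenaming.weaken_qu (Q := R) ⟨h.wf.1, h.wf.2.1⟩
  refine extend_qu hwk.isSubstitution (.var .here ?_)
  exact Qual.rename_eq_subst Nat.succ Q ▸ h.rename hwk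

theorem single_ty (hΓ : Γ.WF) {S U : STy L} (h : STy.Refines Γ U S) :
    IsSubstitution (.ty Γ S) Γ (STy.single U) Qual.var :=
  extend_ty (.id hΓ) (S.subst_var.symm ▸ h)

theorem single_qu {Q R : Qual L} (h : Subqual Γ R Q) :
    IsSubstitution (.qu Γ Q) Γ STy.var (Qual.single R) :=
  extend_qu (.id h.wf.1) (Q.subst_var.symm ▸ h)

end IsSubstitution

mutual
theorem STy.Sub.subst : ∀ {Γ Δ : Ctx L} {τ : ℕ → STy L} {σ : ℕ → Qual L} {S U : STy L},
    STy.Sub Γ S U → IsSubstitution Γ Δ τ σ → STy.Sub Δ (S.subst τ σ) (U.subst τ σ)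
  | _, _, _, _, _, _, .top _ hS, hτ => .top hτ.wf (hτ.sTy_wf hS)
  | _, _, _, _, _, _, .reflVar _ hX, hτ => .refl hτ.wf (hτ.sTy_wf hX)
  | _, _, _, _, _, _, .var hX h, hτ => by
      have hU := (hτ.refines hX).sub (.id hτ.wf) (by simpa using h.subst hτ)
      rwa [STy.rename_id] at hU
  | _, _, _, _, _, _, .arrow h₁ h₂, hτ => .arrow (h₁.subst hτ) (h₂.subst hτ)
  | _, _, _, _, _, _, .all h₁ h₂, hτ =>
      .all (h₁.subst hτ) (h₂.subst (hτ.up_ty h₁.wf.2.1))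
  | _, _, _, _, _, _, .qall h₁ h₂, hτ =>
      .qall (h₁.subst hτ.wf hτ.subqual) (h₂.subst (hτ.up_qu h₁.wf.2.1))
theorem QTy.Sub.subst : ∀ {Γ Δ : Ctx L} {τ : ℕ → STy L} {σ : ℕ → Qual L} {T U : QTy L},
    QTy.Sub Γ T U → IsSubstitution Γ Δ τ σ → QTy.Sub Δ (T.subst τ σ) (U.subst τ σ)
  | _, _, _, _, _, _, .qtype h₁ h₂, hτ => .qtype (h₁.subst hτ.wf hτ.subqual) (h₂.subst hτ)
end

theorem STy.Sub.rename {S U : STy L} (h : STy.Sub Γ S U) (hρ : IsRenaming Γ Δ ρX ρY) :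
    STy.Sub Δ (S.rename ρX ρY) (U.rename ρX ρY) := by
  simpa only [STy.rename_eq_subst] using h.subst hρ.isSubstitution

theorem QTy.Sub.rename {T U : QTy L} (h : QTy.Sub Γ T U) (hρ : IsRenaming Γ Δ ρX ρY) :
    QTy.Sub Δ (T.rename ρX ρY) (U.rename ρX ρY) := by
  simpa only [QTy.rename_eq_subst] using h.subst hρ.isSubstitution

theorem QTy.Sub.narrow_ty {S U : STy L} {T₁ T₂ : QTy L} (h : QTy.Sub (.ty Γ S) T₁ T₂)
    (hU : STy.Refines Γ U S) : QTy.Sub (.ty Γ U) T₁ T₂ := by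
  simpa only [QTy.subst_var] using h.subst (.narrow_ty h.wf.1.1 hU)

theorem QTy.Sub.narrow_qu {Q R : Qual L} {T₁ T₂ : QTy L} (h : QTy.Sub (.qu Γ Q) T₁ T₂)
    (hR : Subqual Γ R Q) : QTy.Sub (.qu Γ R) T₁ T₂ := by
  simpa only [QTy.subst_var] using h.subst (.narrow_qu hR)

end Subtyping

/-! ### Transitivity of subtyping -/

section Transitivity
variable {L : Type*} [Lattice L] [BoundedOrder L] {Γ : Ctx L}

/-- Subtyping is transitive through every renaming of the simple type `M`. Renamings are included
because narrowing moves the bound of a universal type into larger environments; with them,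
structural induction on `M` suffices. -/
def STy.IsCut (M : STy L) : Prop :=
  ∀ ⦃ρX ρY Γ S U⦄, STy.Sub Γ S (M.rename ρX ρY) → STy.Sub Γ (M.rename ρX ρY) U → STy.Sub Γ S U

/-- Subtyping is transitive through every renaming of the qualified type `M`. -/
def QTy.IsCut (M : QTy L) : Prop :=
  ∀ ⦃ρX ρY Γ T U⦄, QTy.Sub Γ T (M.rename ρX ρY) → QTy.Sub Γ (M.rename ρX ρY) U → QTy.Sub Γ T U

theorem STy.IsCut.rename {M : STy L} (hM : M.IsCut) (ρX ρY : ℕ → ℕ) :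
    (M.rename ρX ρY).IsCut := by
  intro ξX ξY Γ S U
  rw [STy.rename_rename]
  exact @hM _ _ _ _ _

theorem STy.IsCut.refines {S M : STy L} (hM : M.IsCut) (h : STy.Sub Γ S M) :
    STy.Refines Γ S M where
  wf := h.wf.2.1
  sub hρ hU := hM (h.rename hρ) hU

theorem STy.Sub.trans_of_ne_var : ∀ {Γ : Ctx L} {S M U : STy L}, STy.Sub Γ S M → STy.Sub Γ M U →
    (∀ {S'}, (∀ X, S' ≠ .var X) → STy.Sub Γ S' M → STy.Sub Γ S' U) → STy.Sub Γ S U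
  | _, _, _, _, .reflVar _ _, hU, _ => hU
  | _, _, _, _, .var hX h, hU, hcut => .var hX (h.trans_of_ne_var hU hcut)
  | _, _, _, _, .top _ hS, .top hΓ _, _ => .top hΓ hS
  | _, _, _, _, .arrow h₁ h₂, _, hcut => hcut nofun (.arrow h₁ h₂)
  | _, _, _, _, .all h₁ h₂, _, hcut => hcut nofun (.all h₁ h₂)
  | _, _, _, _, .qall h₁ h₂, _, hcut => hcut nofun (.qall h₁ h₂)

theorem STy.IsCut.top : (STy.top : STy L).IsCut
  | _, _, _, _, _, h, .top hΓ _ => .top hΓ h.wf.2.1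

theorem STy.IsCut.var (X : ℕ) : (STy.var X : STy L).IsCut := fun _ _ _ _ _ h h' =>
  h.trans_of_ne_var h' fun hne h => match h with
    | .reflVar _ _ | .var _ _ => absurd rfl (hne _)

theorem STy.IsCut.arrow {T₁ T₂ : QTy L} (hT₁ : T₁.IsCut) (hT₂ : T₂.IsCut) :
    (STy.arrow T₁ T₂).IsCut := fun _ _ _ _ _ h h' =>
  h.trans_of_ne_var h' fun hne h => match h, h' with
    | .var _ _, _ => absurd rfl (hne _)
    | h, .top hΓ _ => .top hΓ h.wf.2.1
    | .arrow h₁ h₂, .arrow h₃ h₄ => .arrow (hT₁ h₃ h₁) (hT₂ h₂ h₄)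

theorem STy.IsCut.all {S : STy L} {T : QTy L} (hS : S.IsCut) (hT : T.IsCut) :
    (STy.all S T).IsCut := fun _ _ _ _ _ h h' =>
  h.trans_of_ne_var h' fun hne h => match h, h' with
    | .var _ _, _ => absurd rfl (hne _)
    | h, .top hΓ _ => .top hΓ h.wf.2.1
    | .all h₁ h₂, .all h₃ h₄ =>
        .all (hS h₃ h₁) (hT (h₂.narrow_ty ((hS.rename _ _).refines h₃)) h₄)

theorem STy.IsCut.qall (Q : Qual L) {T : QTy L} (hT : T.IsCut) :
    (STy.qall Q T).IsCut := fun _ _ _ _ _ h h' =>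
  h.trans_of_ne_var h' fun hne h => match h, h' with
    | .var _ _, _ => absurd rfl (hne _)
    | h, .top hΓ _ => .top hΓ h.wf.2.1
    | .qall h₁ h₂, .qall h₃ h₄ => .qall (h₃.trans h₁) (hT (h₂.narrow_qu h₃) h₄)

theorem QTy.IsCut.mk (Q : Qual L) {S : STy L} (hS : S.IsCut) : (QTy.mk Q S).IsCut
  | _, _, _, _, _, .qtype h₁ h₂, .qtype h₃ h₄ => .qtype (h₁.trans h₃) (hS h₂ h₄)

mutual
theorem STy.isCut : ∀ M : STy L, M.IsCut
  | .top => .top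
  | .var X => .var X
  | .arrow T₁ T₂ => .arrow T₁.isCut T₂.isCut
  | .all S T => .all S.isCut T.isCut
  | .qall Q T => .qall Q T.isCut
theorem QTy.isCut : ∀ M : QTy L, M.IsCut
  | .mk Q S => .mk Q S.isCut
end

theorem STy.Sub.trans {S M U : STy L} (h₁ : STy.Sub Γ S M) (h₂ : STy.Sub Γ M U) :
    STy.Sub Γ S U :=
  M.isCut (M.rename_id.symm ▸ h₁) (M.rename_id.symm ▸ h₂)

theorem QTy.Sub.trans {T M U : QTy L} (h₁ : QTy.Sub Γ T M) (h₂ : QTy.Sub Γ M U) :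
    QTy.Sub Γ T U :=
  M.isCut (M.rename_id.symm ▸ h₁) (M.rename_id.symm ▸ h₂)

theorem STy.Sub.refines {S M : STy L} (h : STy.Sub Γ S M) : STy.Refines Γ S M :=
  M.isCut.refines h

end Transitivity

/-! ### Typing -/

section Typing
variable {L : Type*} {Γ Δ : Ctx L} {ρx ρX ρY : ℕ → ℕ}
  {θ : ℕ → Term L} {τ : ℕ → STy L} {σ : ℕ → Qual L}

/-- A renaming of environments that also renames, by `ρx`, the term variables of `Γ` to term
variables of `Δ` that have the renamed types. -/
structure IsTermRenaming (Γ Δ : Ctx L) (ρx ρX ρY : ℕ → ℕ) : Prop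
    extends IsRenaming Γ Δ ρX ρY where
  hasTerm : ∀ {x T}, HasTerm Γ x T → HasTerm Δ (ρx x) (T.rename ρX ρY)

namespace IsTermRenaming

theorem weaken_tm {T : QTy L} (hΓ : (Ctx.tm Γ T).WF) :
    IsTermRenaming Γ (.tm Γ T) Nat.succ id id where
  toIsRenaming := .weaken_tm hΓ
  hasTerm hx := by simpa using hx.tm

theorem weaken_ty {S : STy L} (hΓ : (Ctx.ty Γ S).WF) :
    IsTermRenaming Γ (.ty Γ S) id Nat.succ id where
  toIsRenaming := .weaken_ty hΓ
  hasTerm hx := hx.ty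

theorem weaken_qu {Q : Qual L} (hΓ : (Ctx.qu Γ Q).WF) :
    IsTermRenaming Γ (.qu Γ Q) id id Nat.succ where
  toIsRenaming := .weaken_qu hΓ
  hasTerm hx := hx.qu

theorem up_tm (h : IsTermRenaming Γ Δ ρx ρX ρY) {T : QTy L} (hT : T.WF Γ) :
    IsTermRenaming (.tm Γ T) (.tm Δ (T.rename ρX ρY)) (upRen ρx) ρX ρY where
  toIsRenaming := h.toIsRenaming.up_tm hT
  hasTerm
    | .here => .here
    | .tm hx => .tm (h.hasTerm hx)

theorem up_ty (h : IsTermRenaming Γ Δ ρx ρX ρY) {S : STy L} (hS : S.WF Γ) :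
    IsTermRenaming (.ty Γ S) (.ty Δ (S.rename ρX ρY)) ρx (upRen ρX) ρY where
  toIsRenaming := h.toIsRenaming.up_ty hS
  hasTerm | .ty hx => QTy.rename_upRen_rename_succ ρX ρY _ ▸ .ty (h.hasTerm hx)

theorem up_qu (h : IsTermRenaming Γ Δ ρx ρX ρY) {Q : Qual L} (hQ : Q.WF Γ) :
    IsTermRenaming (.qu Γ Q) (.qu Δ (Q.rename ρY)) ρx ρX (upRen ρY) where
  toIsRenaming := h.toIsRenaming.up_qu hQ
  hasTerm | .qu hx => QTy.rename_qupRen_rename_succ ρX ρY _ ▸ .qu (h.hasTerm hx)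

end IsTermRenaming

variable [Lattice L] [BoundedOrder L]

theorem Typing.wf {t : Term L} {T : QTy L} (h : Typing Γ t T) : Γ.WF ∧ T.WF Γ := by
  induction h with
  | var hΓ hx => exact ⟨hΓ, hx.wf hΓ⟩
  | abs hP _ ih => exact ⟨ih.1.1, hP, ih.1.2, ih.2.strengthen_tm⟩
  | app _ _ ih _ => exact ⟨ih.1, ih.2.2.2⟩
  | tabs hP _ ih => exact ⟨ih.1.1, hP, ih.1.2, ih.2⟩
  | tapp _ hS ih => exact ⟨ih.1, (IsSubstitution.single_ty ih.1 hS.refines).qTy_wf ih.2.2.2⟩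
  | qabs hP _ ih => exact ⟨ih.1.1, hP, ih.1.2, ih.2⟩
  | qapp _ hQ ih => exact ⟨ih.1, (IsSubstitution.single_qu hQ).qTy_wf ih.2.2.2⟩
  | assertq _ _ ih => exact ih
  | upqual _ hP ih => exact ⟨ih.1, hP.wf.2.2, ih.2.2⟩
  | sub _ hT ih => exact ⟨ih.1, hT.wf.2.2⟩

theorem Typing.rename {t : Term L} {T : QTy L} (h : Typing Γ t T)
    (hρ : IsTermRenaming Γ Δ ρx ρX ρY) :
    Typing Δ (t.rename ρx ρX ρY) (T.rename ρX ρY) := by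
  induction h generalizing Δ ρx ρX ρY with
  | var _ hx => exact .var hρ.wf (hρ.hasTerm hx)
  | abs hP ht ih => exact .abs (hρ.qual_wf hP) (ih (hρ.up_tm ht.wf.1.2))
  | app _ _ ih₁ ih₂ => exact .app (ih₁ hρ) (ih₂ hρ)
  | tabs hP ht ih => exact .tabs (hρ.qual_wf hP) (ih (hρ.up_ty ht.wf.1.2))
  | tapp _ hS ih => exact QTy.rename_substTy .. ▸ .tapp (ih hρ) (hS.rename hρ.toIsRenaming)
  | qabs hP ht ih => exact .qabs (hρ.qual_wf hP) (ih (hρ.up_qu ht.wf.1.2))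
  | qapp _ hQ ih => exact QTy.rename_substQual .. ▸ .qapp (ih hρ) (hQ.rename hρ.toIsRenaming)
  | assertq _ hQ ih => exact .assertq (ih hρ) (hQ.rename hρ.toIsRenaming)
  | upqual _ hQ ih => exact .upqual (ih hρ) (hQ.rename hρ.toIsRenaming)
  | sub _ hT ih => exact .sub (ih hρ) (hT.rename hρ.toIsRenaming)

/-- A substitution between environments that also substitutes, by `θ`, for the term variables of
`Γ` terms over `Δ` that have the substituted types. -/
structure IsTermSubstitution (Γ Δ : Ctx L) (θ : ℕ → Term L) (τ : ℕ → STy L) (σ : ℕ → Qual L) :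
    Prop extends IsSubstitution Γ Δ τ σ where
  typing : ∀ {x T}, HasTerm Γ x T → Typing Δ (θ x) (T.subst τ σ)

namespace IsTermSubstitution

theorem up_tm (h : IsTermSubstitution Γ Δ θ τ σ) {T : QTy L} (hT : T.WF Γ) :
    IsTermSubstitution (.tm Γ T) (.tm Δ (T.subst τ σ)) (Term.up θ) τ σ where
  toIsSubstitution := h.toIsSubstitution.up_tm hT
  typing
    | .here => .var ⟨h.wf, h.qTy_wf hT⟩ .here
    | .tm hx => by
        simpa [Term.up] using (h.typing hx).rename (.weaken_tm ⟨h.wf, h.qTy_wf hT⟩)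

theorem up_ty (h : IsTermSubstitution Γ Δ θ τ σ) {S : STy L} (hS : S.WF Γ) :
    IsTermSubstitution (.ty Γ S) (.ty Δ (S.subst τ σ)) (fun n => (θ n).rename id Nat.succ id)
      (STy.up τ) σ where
  toIsSubstitution := h.toIsSubstitution.up_ty hS
  typing
    | .ty hx => QTy.subst_up_rename_succ τ σ _ ▸
        (h.typing hx).rename (.weaken_ty ⟨h.wf, h.sTy_wf hS⟩)

theorem up_qu (h : IsTermSubstitution Γ Δ θ τ σ) {Q : Qual L} (hQ : Q.WF Γ) :
    IsTermSubstitution (.qu Γ Q) (.qu Δ (Q.subst σ)) (fun n => (θ n).rename id id Nat.succ)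
      (STy.qup τ) (Qual.up σ) where
  toIsSubstitution := h.toIsSubstitution.up_qu hQ
  typing
    | .qu hx => QTy.subst_qup_rename_succ τ σ _ ▸
        (h.typing hx).rename (.weaken_qu ⟨h.wf, h.qual_wf hQ⟩)

theorem single_tm {v : Term L} {T : QTy L} (hv : Typing Γ v T) :
    IsTermSubstitution (.tm Γ T) Γ (Term.single v) STy.var Qual.var where
  toIsSubstitution := (IsSubstitution.id hv.wf.1).extend_tm T
  typing
    | .here => T.subst_var.symm ▸ hv
    | .tm hx => (QTy.subst_var _).symm ▸ .var hv.wf.1 hx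

theorem single_ty {S U : STy L} (h : STy.Sub Γ U S) :
    IsTermSubstitution (.ty Γ S) Γ Term.var (STy.single U) Qual.var where
  toIsSubstitution := .single_ty h.wf.1 h.refines
  typing | .ty hx => (QTy.subst_single_rename_succ _ U).symm ▸ .var h.wf.1 hx

theorem single_qu {Q R : Qual L} (h : Subqual Γ R Q) :
    IsTermSubstitution (.qu Γ Q) Γ Term.var STy.var (Qual.single R) where
  toIsSubstitution := .single_qu h
  typing | .qu hx => (QTy.subst_qsingle_rename_succ _ R).symm ▸ .var h.wf.1 hx

end IsTermSubstitution

theorem Typing.subst {t : Term L} {T : QTy L} (h : Typing Γ t T)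
    (hθ : IsTermSubstitution Γ Δ θ τ σ) : Typing Δ (t.subst θ τ σ) (T.subst τ σ) := by
  induction h generalizing Δ θ τ σ with
  | var _ hx => exact hθ.typing hx
  | abs hP ht ih => exact .abs (hθ.qual_wf hP) (ih (hθ.up_tm ht.wf.1.2))
  | app _ _ ih₁ ih₂ => exact .app (ih₁ hθ) (ih₂ hθ)
  | tabs hP ht ih => exact .tabs (hθ.qual_wf hP) (ih (hθ.up_ty ht.wf.1.2))
  | tapp _ hS ih => exact QTy.subst_substTy .. ▸ .tapp (ih hθ) (hS.subst hθ.toIsSubstitution)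
  | qabs hP ht ih => exact .qabs (hθ.qual_wf hP) (ih (hθ.up_qu ht.wf.1.2))
  | qapp _ hQ ih => exact QTy.subst_substQual .. ▸ .qapp (ih hθ) (hQ.subst hθ.wf hθ.subqual)
  | assertq _ hQ ih => exact .assertq (ih hθ) (hQ.subst hθ.wf hθ.subqual)
  | upqual _ hQ ih => exact .upqual (ih hθ) (hQ.subst hθ.wf hθ.subqual)
  | sub _ hT ih => exact .sub (ih hθ) (hT.subst hθ.toIsSubstitution)

theorem Typing.substTerm {t v : Term L} {T U : QTy L} (h : Typing (.tm Γ U) t T)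
    (hv : Typing Γ v U) : Typing Γ (t.substTerm v) T :=
  T.subst_var ▸ h.subst (.single_tm hv)

theorem Typing.substTy {t : Term L} {T : QTy L} {S U : STy L} (h : Typing (.ty Γ S) t T)
    (hU : STy.Sub Γ U S) : Typing Γ (t.substTy U) (T.substTy U) :=
  h.subst (.single_ty hU)

theorem Typing.substQual {t : Term L} {T : QTy L} {Q R : Qual L} (h : Typing (.qu Γ Q) t T)
    (hR : Subqual Γ R Q) : Typing Γ (t.substQual R) (T.substQual R) :=
  h.subst (.single_qu hR)

theorem Typing.abs_inv {P : Qual L} {T V : QTy L} {t : Term L} (h : Typing Γ (.abs P T t) V) :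
    ∃ U, Typing (.tm Γ T) t U ∧ QTy.Sub Γ (.mk P (.arrow T U)) V := by
  generalize hs : Term.abs P T t = s at h
  induction h with
  | abs hP ht => cases hs; exact ⟨_, ht, .refl ht.wf.1.1 (Typing.abs hP ht).wf.2⟩
  | sub _ hV ih =>
    obtain ⟨U, ht, hU⟩ := ih hs
    exact ⟨U, ht, hU.trans hV⟩
  | _ => cases hs

theorem Typing.tabs_inv {P : Qual L} {R : STy L} {V : QTy L} {t : Term L}
    (h : Typing Γ (.tabs P R t) V) :
    ∃ U, Typing (.ty Γ R) t U ∧ QTy.Sub Γ (.mk P (.all R U)) V := by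
  generalize hs : Term.tabs P R t = s at h
  induction h with
  | tabs hP ht => cases hs; exact ⟨_, ht, .refl ht.wf.1.1 (Typing.tabs hP ht).wf.2⟩
  | sub _ hV ih =>
    obtain ⟨U, ht, hU⟩ := ih hs
    exact ⟨U, ht, hU.trans hV⟩
  | _ => cases hs

theorem Typing.qabs_inv {P R : Qual L} {V : QTy L} {t : Term L}
    (h : Typing Γ (.qabs P R t) V) :
    ∃ U, Typing (.qu Γ R) t U ∧ QTy.Sub Γ (.mk P (.qall R U)) V := by
  generalize hs : Term.qabs P R t = s at h
  induction h with
  | qabs hP ht => cases hs; exact ⟨_, ht, .refl ht.wf.1.1 (Typing.qabs hP ht).wf.2⟩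
  | sub _ hV ih =>
    obtain ⟨U, ht, hU⟩ := ih hs
    exact ⟨U, ht, hU.trans hV⟩
  | _ => cases hs

theorem Typing.retag {v : Term L} {P Q R : Qual L} {S : STy L} (h : Typing Γ v (.mk Q S))
    (hv : ValueTag v R) (hP : P.WF Γ) : Typing Γ (v.retag P) (.mk P S) := by
  have hPP : Subqual Γ P P := .refl h.wf.1 hP
  cases hv with
  | abs =>
    have ⟨_, ht, .qtype _ hU⟩ := h.abs_inv
    exact .sub (.abs hP ht) (.qtype hPP hU)
  | tabs =>
    have ⟨_, ht, .qtype _ hU⟩ := h.tabs_inv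
    exact .sub (.tabs hP ht) (.qtype hPP hU)
  | qabs =>
    have ⟨_, ht, .qtype _ hU⟩ := h.qabs_inv
    exact .sub (.qabs hP ht) (.qtype hPP hU)

theorem Typing.beta {P Q : Qual L} {T T₁ T₂ : QTy L} {t v : Term L}
    (h : Typing Γ (.abs P T t) (.mk Q (.arrow T₁ T₂))) (hv : Typing Γ v T₁) :
    Typing Γ (t.substTerm v) T₂ := by
  have ⟨_, ht, .qtype _ (.arrow hT₁ hT₂)⟩ := h.abs_inv
  exact .sub (ht.substTerm (.sub hv hT₁)) hT₂

theorem Typing.betaT {P Q : Qual L} {R S S' : STy L} {T : QTy L} {t : Term L}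
    (h : Typing Γ (.tabs P R t) (.mk Q (.all S T))) (hS' : STy.Sub Γ S' S) :
    Typing Γ (t.substTy S') (T.substTy S') := by
  have ⟨_, ht, .qtype _ (.all hS hT)⟩ := h.tabs_inv
  exact .sub (ht.substTy (hS'.trans hS)) (hT.subst (.single_ty hS'.wf.1 hS'.refines))

theorem Typing.betaQ {P Q R R' Q' : Qual L} {T : QTy L} {t : Term L}
    (h : Typing Γ (.qabs P R t) (.mk R' (.qall Q T))) (hQ' : Subqual Γ Q' Q) :
    Typing Γ (t.substQual Q') (T.substQual Q') := by
  have ⟨_, ht, .qtype _ (.qall hQ hT)⟩ := h.qabs_inv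
  exact .sub (ht.substQual (hQ'.trans hQ)) (hT.subst (.single_qu hQ'))

end Typing

end FsubQ

open FsubQ in
theorem mainTheorem3_general {L : Type*} [Lattice L] [BoundedOrder L] {Γ : Ctx L} {s t : Term L}
    {T : QTy L} (hs : Typing Γ s T) (hst : Step s t) : Typing Γ t T := by
  induction hs generalizing t with
  | var | abs | tabs | qabs => cases hst
  | app hs ht ihs iht =>
    cases hst with
    | beta _ => exact hs.beta ht
    | app₁ h => exact .app (ihs h) ht
    | app₂ _ h => exact .app hs (iht h)
  | tapp hs hS ih =>
    cases hst with
    | betaT => exact hs.betaT hS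
    | tapp h => exact .tapp (ih h) hS
  | qapp hs hQ ih =>
    cases hst with
    | betaQ => exact hs.betaQ hQ
    | qapp h => exact .qapp (ih h) hQ
  | assertq hs hQ ih =>
    cases hst with
    | assertq => exact hs
    | assertqCongr h => exact .assertq (ih h) hQ
  | upqual hs hQ ih =>
    cases hst with
    | upqual hv => exact hs.retag hv hQ.wf.2.2
    | upqualCongr h => exact .upqual (ih h) hQ
  | sub _ hT ih => exact .sub (ih hst) hT

theorem mainTheorem3 {L : Type*} [Lattice L] [BoundedOrder L] [Countable L]
    (Γ : FsubQ.Ctx L) (s t : FsubQ.Term L) (T : FsubQ.QTy L)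
    (hs : FsubQ.Typing Γ s T) (hst : FsubQ.Step s t) :
    FsubQ.Typing Γ t T :=
  mainTheorem3_general hs hst
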